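/- Let $y\mid\beta\sim N_p(\beta,I_p)$ with $\beta\in\mathbb R^p$ estimated under the quadratic loss $\|\hat\beta-\beta\|^2$, let $\beta\mid\kappa\sim N_p(0,\kappa^{-1}(1-\kappa)I_p)$, and let $\kappa\in(0,1)$ have the (possibly improper) prior density $$\pi(\kappa)=\kappa^{a-1}(1-\kappa)^{b-1}h(\kappa),\qquad h(\kappa)=(1+c_3\kappa)^{c_4}e^{d\kappa},\qquad c_3>0,\quad -\tfrac p2\le a<\tfrac p2-2 .$$ The (generalized) Bayes estimator is $$\hat\beta(y)=\Bigl(1-\frac{\int_0^1\kappa^{p/2+1}e^{-\kappa\|y\|^2/2}\pi(\kappa)\,d\kappa}{\int_0^1\kappa^{p/2}e^{-\kappa\|y\|^2/2}\pi(\kappa)\,d\kappa}\Bigr)y ,$$ the quotient being $0$ if the integral in the denominator is $+\infty$ (which happens exactly if $a=-p/2$). An estimator is minimax if it minimizes the supremum over $\beta$ of the risk $E\|\hat\beta(Y)-\beta\|^2$, $Y\sim N_p(\beta,I_p)$, among all measurable estimators. Put $H(\kappa)=\kappa h'(\kappa)/h(\kappa)$ for $\kappa\in[0,1]$, so that $H(1)=d+\frac{c_3c_4}{1+c_3}$.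 1. Suppose that either $d\ge 0$ and $c_4\le -(c_3+1)^2d/c_3$, or $d<0$ and $c_4\le -d/c_3$; suppose also that $d+\frac{c_3c_4}{1+c_3}\ge-\max\{\tfrac p2-a-2,\ \tfrac p2+a+2\}$. Then $H$ is monotone non-increasing on $[0,1]$, and $\hat\beta$ is minimax for every $b$ with $\frac{p+2a+2}{3p/2+a}\le b<1$. 2. Suppose that either $d\ge 0$ and $c_4\ge -d/c_3$, or $d<0$ and $c_4> -(c_3+1)^2d/c_3$; suppose also that $d+\frac{c_3c_4}{1+c_3}\le\tfrac12\bigl(\tfrac p2-a-2\bigr)$. Then $H$ is monotone non-decreasing on $[0,1]$, and $\hat\beta$ is minimax for every $b$ with $\frac{p+2a+2+2\{d+c_3c_4/(1+c_3)\}}{3p/2+a}\le b<1$. Moreover, in both cases, if $a>-p/2$, then for every $y$ the marginal density of $y$ is positive and finite, the posterior distribution of $\beta$ given $y$ has a finite mean, and $\hat\beta(y)$ is that mean. -/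

import Mathlib

open MeasureTheory Set
open scoped ENNReal

namespace HalfCauchy

/-- Density at `y` of the normal distribution `N_p(β, I_p)`. -/
noncomputable def gaussianDensity {p : ℕ} (β y : EuclideanSpace ℝ (Fin p)) : ℝ :=
  (2 * Real.pi) ^ (-(p : ℝ) / 2) * Real.exp (-‖y - β‖ ^ 2 / 2)

/-- The normal distribution `N_p(β, I_p)`, the law of the observation `y` given the mean `β`. -/
noncomputable def gaussianLaw {p : ℕ} (β : EuclideanSpace ℝ (Fin p)) :
    Measure (EuclideanSpace ℝ (Fin p)) :=
  volume.withDensity fun y => ENNReal.ofReal (gaussianDensity β y)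

/-- Quadratic risk `E ‖δ(Y) - β‖²`, `Y ∼ N_p(β, I_p)`, of the estimator `δ` (possibly `∞`). -/
noncomputable def risk {p : ℕ} (δ : EuclideanSpace ℝ (Fin p) → EuclideanSpace ℝ (Fin p))
    (β : EuclideanSpace ℝ (Fin p)) : ℝ≥0∞ :=
  ∫⁻ y, ENNReal.ofReal (‖δ y - β‖ ^ 2) ∂(gaussianLaw β)

/-- An estimator is minimax if it is measurable and its maximal risk is at most that of every
other estimator. -/
def IsMinimax {p : ℕ} (δ : EuclideanSpace ℝ (Fin p) → EuclideanSpace ℝ (Fin p)) : Prop :=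
  Measurable δ ∧
    ∀ δ' : EuclideanSpace ℝ (Fin p) → EuclideanSpace ℝ (Fin p), Measurable δ' →
      (⨆ β, risk δ β) ≤ ⨆ β, risk δ' β

/-- The (possibly improper) density `κ ^ (a - 1) (1 - κ) ^ (b - 1) h(κ)` on `(0, 1)`. -/
noncomputable def priorKappa (a b : ℝ) (h : ℝ → ℝ) (κ : ℝ) : ℝ :=
  κ ^ (a - 1) * (1 - κ) ^ (b - 1) * h κ

/-- The factor `(1 + c₃ κ) ^ c₄ exp (d κ)`. -/
noncomputable def hypergeometricFactor (c₃ c₄ d κ : ℝ) : ℝ :=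
  (1 + c₃ * κ) ^ c₄ * Real.exp (d * κ)

/-- `H(κ) = κ h'(κ) / h(κ)`. -/
noncomputable def logSlope (h : ℝ → ℝ) (κ : ℝ) : ℝ :=
  κ * deriv h κ / h κ

/-- Density of `β` when `β ∣ κ ∼ N_p(0, κ⁻¹ (1 - κ) I_p)` and `κ` has density `q` on `(0, 1)`. -/
noncomputable def priorBeta {p : ℕ} (q : ℝ → ℝ) (β : EuclideanSpace ℝ (Fin p)) : ℝ≥0∞ :=
  ∫⁻ κ in Ioo (0 : ℝ) 1, ENNReal.ofReal
    ((2 * Real.pi) ^ (-(p : ℝ) / 2) * (κ / (1 - κ)) ^ ((p : ℝ) / 2) *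
      Real.exp (-(κ / (1 - κ)) * (‖β‖ ^ 2 / 2)) * q κ)

/-- Marginal density `m(y)` of the observation. -/
noncomputable def marginal {p : ℕ} (q : ℝ → ℝ) (y : EuclideanSpace ℝ (Fin p)) : ℝ≥0∞ :=
  ∫⁻ β, ENNReal.ofReal (gaussianDensity β y) * priorBeta q β

/-- Posterior distribution of `β` given `y`. -/
noncomputable def posterior {p : ℕ} (q : ℝ → ℝ) (y : EuclideanSpace ℝ (Fin p)) :
    Measure (EuclideanSpace ℝ (Fin p)) :=
  (marginal q y)⁻¹ •
    volume.withDensity fun β => ENNReal.ofReal (gaussianDensity β y) * priorBeta q β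

/-- For every observation the posterior distribution of `β` is a genuine probability distribution
with finite mean, and `δ` is its mean. -/
def IsPosteriorMean {p : ℕ} (q : ℝ → ℝ)
    (δ : EuclideanSpace ℝ (Fin p) → EuclideanSpace ℝ (Fin p)) : Prop :=
  ∀ y, marginal q y ≠ 0 ∧ marginal q y ≠ ∞ ∧
    Integrable (fun β => β) (posterior q y) ∧ δ y = ∫ β, β ∂(posterior q y)

/-- The posterior mean `E[κ ∣ y]` of the shrinkage coefficient, as a quotient in `[0, ∞]`. -/
noncomputable def shrinkage {p : ℕ} (q : ℝ → ℝ) (y : EuclideanSpace ℝ (Fin p)) : ℝ≥0∞ :=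
  (∫⁻ κ in Ioo (0 : ℝ) 1,
      ENNReal.ofReal (κ ^ ((p : ℝ) / 2 + 1) * Real.exp (-κ * (‖y‖ ^ 2 / 2)) * q κ)) /
    ∫⁻ κ in Ioo (0 : ℝ) 1,
      ENNReal.ofReal (κ ^ ((p : ℝ) / 2) * Real.exp (-κ * (‖y‖ ^ 2 / 2)) * q κ)

/-- The (generalized) Bayes estimator `y ↦ (1 - E[κ ∣ y]) y`. -/
noncomputable def bayesEstimator {p : ℕ} (q : ℝ → ℝ) (y : EuclideanSpace ℝ (Fin p)) :
    EuclideanSpace ℝ (Fin p) :=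
  (1 - (shrinkage q y).toReal) • y

end HalfCauchy

/-! Write `α = p/2 + a`, `w = ‖y‖²/2`, and let `M_k(w)` be the integral of `κ^k e^(-wκ)` against
`κ^(α-1) (1-κ)^(b-1) h(κ) dκ` on `(0,1)`. For `α > 0` the estimator is `(1 - φ(w)) y` with `φ =
M₁/M₀`.

The number `p` is the limit of the Bayes risks `p τ/(1+τ)` of the priors `N_p(0, τ I)`, so no
estimator has maximal risk below `p`, and it suffices that the risk never exceeds `p`
(`isMinimax_of_risk_le`). By Stein's identity the risk minus `p` is the expectation of `2 (w φ² - p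
φ - 2 w φ')`. Since `M_k' = -M_(k+1)`, it is enough to show `2 w M₂ M₀ - w M₁² - p M₁ M₀ ≤ 0` for
all `w ≥ 0` (`risk_shrink_le`, `isMinimax_bayesEstimator_of_stein`).

Integration by parts in `κ` gives one identity for each order `k` (`PartsIdentity`). The one with `k
= 0` expresses `w M₁` through `w M₂`, so that an upper bound on `w M₂ / M₁` is all that is missing.
The one with `k = 1` gives a differential inequality that keeps this ratio below `c/b`
(`mul_moment_le_of_diff_ineq`), where `c` is `α + 1` plus a bound, valid for all tilts `v ≤ w`, on
the mean of `H` with weight `κ (1-κ) e^(-vκ)`.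

If `H` is non-decreasing, that bound is `H(1)`. If `H` is non-increasing, Chebyshev's inequality
shows that the mean is largest at `v = w`, and is there at most the mean of `H` with weight `(1-κ)
e^(-wκ)`. This last mean also enters the `k = 0` identity, and its total contribution has the
favourable sign. What remains is `2α + 2 ≤ b (p + α)`, with `2 H(1)` added on the left in the
non-decreasing case: the lower bound on `b`.

If `α = 0`, the denominator of the shrinkage factor diverges and the estimator is `y`, of risk `p`.
The posterior-mean claim holds because, given `κ` and `y`, `β` is `N_p((1-κ) y, (1-κ) I)`. -/

namespace HalfCauchy

/-- Density at `z` of the centred normal distribution `N_p(0, v I_p)`. -/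
noncomputable def gauss {p : ℕ} (v : ℝ) (z : EuclideanSpace ℝ (Fin p)) : ℝ :=
  (2 * Real.pi * v) ^ (-(p : ℝ) / 2) * Real.exp (-‖z‖ ^ 2 / (2 * v))

/-! ### Gaussian integrals and Stein's identity. -/

section Gauss

variable {p : ℕ} {v : ℝ} {F : Type*} [NormedAddCommGroup F] [NormedSpace ℝ F]

lemma gaussianDensity_eq_gauss (β y : EuclideanSpace ℝ (Fin p)) :
    gaussianDensity β y = gauss 1 (y - β) := by
  simp [gaussianDensity, gauss]

lemma gauss_pos (hv : 0 < v) (z : EuclideanSpace ℝ (Fin p)) : 0 < gauss v z := by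
  unfold gauss; positivity

lemma gauss_neg (z : EuclideanSpace ℝ (Fin p)) : gauss v (-z) = gauss v z := by
  simp [gauss]

@[fun_prop]
lemma continuous_gauss : Continuous (gauss (p := p) v) := by
  unfold gauss; fun_prop

lemma integral_gauss (hv : 0 < v) : ∫ z : EuclideanSpace ℝ (Fin p), gauss v z = 1 := by
  have h := GaussianFourier.integral_rexp_neg_mul_sq_norm (V := EuclideanSpace ℝ (Fin p))
    (b := 1 / (2 * v)) (by positivity)
  have e : ∀ z : EuclideanSpace ℝ (Fin p),
      gauss v z = (2 * Real.pi * v) ^ (-(p : ℝ) / 2) * Real.exp (-(1 / (2 * v)) * ‖z‖ ^ 2) := by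
    intro z; unfold gauss; congr 2; ring
  simp_rw [e]
  rw [integral_const_mul, h, finrank_euclideanSpace_fin,
    show Real.pi / (1 / (2 * v)) = 2 * Real.pi * v by field_simp,
    ← Real.rpow_add (by positivity)]
  simp [neg_div]

lemma integrable_gauss (hv : 0 < v) : Integrable (gauss (p := p) v) :=
  Integrable.of_integral_ne_zero (by rw [integral_gauss hv]; norm_num)

lemma integral_gauss_sub (hv : 0 < v) (u : EuclideanSpace ℝ (Fin p)) :
    ∫ z, gauss v (z - u) = 1 := by
  rw [integral_sub_right_eq_self (gauss v) u, integral_gauss hv]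

/-- From `t + 1 ≤ e^t` with `t = ‖z‖²/(4v)`, the quadratic factor costs only a doubling of the
variance. -/
lemma integrable_sq_norm_mul_gauss (hv : 0 < v) :
    Integrable fun z : EuclideanSpace ℝ (Fin p) => gauss v z * (1 + ‖z‖ ^ 2) := by
  have hg := (integrable_gauss (p := p) (v := 2 * v) (by positivity)).const_mul
    ((2 * Real.pi * v) ^ (-(p : ℝ) / 2) / (2 * Real.pi * (2 * v)) ^ (-(p : ℝ) / 2) * (1 + 4 * v))
  refine hg.mono' (by fun_prop) (.of_forall fun z => ?_)
  rw [Real.norm_of_nonneg (mul_nonneg (gauss_pos hv z).le (by positivity))]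
  have h1 : ‖z‖ ^ 2 ≤ 4 * v * Real.exp (‖z‖ ^ 2 / (4 * v)) := by
    have := Real.add_one_le_exp (‖z‖ ^ 2 / (4 * v))
    rw [mul_comm, ← div_le_iff₀ (by positivity)]; linarith
  have h2 : 1 ≤ Real.exp (‖z‖ ^ 2 / (4 * v)) := Real.one_le_exp (by positivity)
  have h3 : Real.exp (-‖z‖ ^ 2 / (2 * v)) * Real.exp (‖z‖ ^ 2 / (4 * v)) =
      Real.exp (-‖z‖ ^ 2 / (2 * (2 * v))) := by
    rw [← Real.exp_add]; congr 1; field_simp; ring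
  have h4 : (0:ℝ) < (2 * Real.pi * (2 * v)) ^ (-(p : ℝ) / 2) := by positivity
  calc gauss v z * (1 + ‖z‖ ^ 2)
      ≤ gauss v z * ((1 + 4 * v) * Real.exp (‖z‖ ^ 2 / (4 * v))) :=
        mul_le_mul_of_nonneg_left (by linarith) (gauss_pos hv z).le
    _ = (2 * Real.pi * v) ^ (-(p : ℝ) / 2) * (1 + 4 * v) *
        (Real.exp (-‖z‖ ^ 2 / (2 * v)) * Real.exp (‖z‖ ^ 2 / (4 * v))) := by unfold gauss; ring
    _ = _ := by rw [h3]; unfold gauss; field_simp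

/-- The standard integrability test below: it leaves only a pointwise quadratic growth bound to
check. -/
lemma integrable_gauss_smul (hv : 0 < v) (u : EuclideanSpace ℝ (Fin p))
    {f : EuclideanSpace ℝ (Fin p) → F} (hf : AEStronglyMeasurable f volume) (C : ℝ)
    (hC : ∀ z, ‖f z‖ ≤ C * (1 + ‖z‖ ^ 2)) :
    Integrable fun z => gauss v (z - u) • f z := by
  have hC0 : 0 ≤ C := by simpa using (norm_nonneg _).trans (hC 0)
  have hg := ((integrable_sq_norm_mul_gauss (p := p) hv).comp_sub_right u).const_mul
    (C * (2 + 2 * ‖u‖ ^ 2))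
  refine hg.mono' (.smul (by fun_prop) hf) (.of_forall fun z => ?_)
  have h0 := gauss_pos hv (z - u)
  rw [norm_smul, Real.norm_of_nonneg h0.le]
  have h1 : 1 + ‖z‖ ^ 2 ≤ (2 + 2 * ‖u‖ ^ 2) * (1 + ‖z - u‖ ^ 2) := by
    have : ‖z‖ ≤ ‖z - u‖ + ‖u‖ := by simpa using norm_add_le (z - u) u
    nlinarith [sq_nonneg (‖z - u‖ - ‖u‖), norm_nonneg z, mul_nonneg (sq_nonneg ‖u‖)
      (sq_nonneg ‖z - u‖), norm_nonneg (z - u), norm_nonneg u]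
  calc gauss v (z - u) * ‖f z‖ ≤ gauss v (z - u) * (C * (1 + ‖z‖ ^ 2)) := by gcongr; exact hC z
    _ ≤ gauss v (z - u) * (C * ((2 + 2 * ‖u‖ ^ 2) * (1 + ‖z - u‖ ^ 2))) := by gcongr
    _ = _ := by ring

lemma hasLineDerivAt_gauss_sub (hv : 0 < v) (u z : EuclideanSpace ℝ (Fin p)) (i : Fin p) :
    HasLineDerivAt ℝ (fun z => gauss v (z - u)) (-((z - u) i / v) * gauss v (z - u)) z
      (EuclideanSpace.single i 1) := by
  have hn : ∀ t : ℝ, ‖z + t • EuclideanSpace.single i (1:ℝ) - u‖ ^ 2 =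
      ‖z - u‖ ^ 2 + 2 * t * (z - u) i + t ^ 2 := by
    intro t
    rw [add_sub_right_comm, norm_add_sq_real, real_inner_smul_right,
      EuclideanSpace.inner_single_right, norm_smul]
    simp; ring
  unfold HasLineDerivAt gauss
  simp_rw [hn]
  have h1 : HasDerivAt (fun t : ℝ => -(‖z - u‖ ^ 2 + 2 * t * (z - u) i + t ^ 2) / (2 * v))
      (-((z - u) i / v)) 0 := by
    have h := (((((hasDerivAt_id (0:ℝ)).const_mul 2).mul_const ((z - u) i)).const_add
      (‖z - u‖ ^ 2)).add ((hasDerivAt_id (0:ℝ)).pow 2)).neg.div_const (2 * v)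
    convert! h using 1
    simp; field_simp
  convert! (h1.exp).const_mul ((2 * Real.pi * v) ^ (-(p : ℝ) / 2)) using 1
  simp; ring

/-- Stein's identity for one coordinate. -/
lemma integral_gauss_mul_coord (hv : 0 < v) (u : EuclideanSpace ℝ (Fin p)) (i : Fin p)
    {f f' : EuclideanSpace ℝ (Fin p) → ℝ} (hf : AEStronglyMeasurable f volume)
    (hf' : AEStronglyMeasurable f' volume)
    (hd : ∀ z, HasLineDerivAt ℝ f (f' z) z (EuclideanSpace.single i 1)) (C : ℝ)
    (hC : ∀ z, |f z| ≤ C * (1 + ‖z‖)) (hC' : ∀ z, |f' z| ≤ C * (1 + ‖z‖ ^ 2)) :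
    ∫ z, gauss v (z - u) * ((z - u) i * f z) = v * ∫ z, gauss v (z - u) * f' z := by
  have hC0 : 0 ≤ C := by simpa using (abs_nonneg _).trans (hC 0)
  have hcoord : ∀ z, |(z - u) i| ≤ ‖z‖ + ‖u‖ := fun z =>
    (PiLp.norm_apply_le (z - u) i).trans (norm_sub_le _ _)
  have i1 : Integrable fun z => gauss v (z - u) * f' z :=
    integrable_gauss_smul hv u hf' C hC'
  have i2 : Integrable fun z => gauss v (z - u) * f z := by
    refine integrable_gauss_smul hv u hf (2 * C) fun z => (hC z).trans ?_
    nlinarith [sq_nonneg (‖z‖ - 1), mul_nonneg hC0 (sq_nonneg (‖z‖ - 1)),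
      mul_nonneg hC0 (sq_nonneg ‖z‖)]
  have i3 : Integrable fun z => gauss v (z - u) * ((z - u) i * f z) := by
    refine integrable_gauss_smul hv u (.mul (by fun_prop) hf) (2 * C * (1 + ‖u‖)) fun z => ?_
    rw [Real.norm_eq_abs, abs_mul]
    calc |(z - u) i| * |f z| ≤ (‖z‖ + ‖u‖) * (C * (1 + ‖z‖)) :=
          mul_le_mul (hcoord z) (hC z) (abs_nonneg _) (by positivity)
      _ = C * ((‖z‖ + ‖u‖) * (1 + ‖z‖)) := by ring
      _ ≤ C * (2 * (1 + ‖u‖) * (1 + ‖z‖ ^ 2)) := by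
          refine mul_le_mul_of_nonneg_left ?_ hC0
          nlinarith [sq_nonneg (‖z‖ - 1), norm_nonneg z, norm_nonneg u,
            mul_nonneg (norm_nonneg u) (sq_nonneg (‖z‖ - 1)),
            mul_nonneg (norm_nonneg u) (sq_nonneg ‖z‖)]
      _ = _ := by ring
  -- Integration by parts along the `i`-th axis, the derivative of the Gaussian being `-(z - u)ᵢ /
  -- v` times itself.
  have key := integral_bilinear_hasLineDerivAt_right_eq_neg_left_of_integrable
    (μ := (volume : Measure (EuclideanSpace ℝ (Fin p)))) (f := f) (f' := f')
    (g := fun z => gauss v (z - u)) (g' := fun z => -((z - u) i / v) * gauss v (z - u))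
    (v := EuclideanSpace.single i 1) (B := ContinuousLinearMap.mul ℝ ℝ)
    (by simpa [mul_comm] using i1)
    (by
      refine (i3.const_mul (-(1 / v))).congr (.of_forall fun z => ?_)
      simp; ring)
    (by simpa [mul_comm] using i2)
    (fun z _ => hd z) (fun z _ => hasLineDerivAt_gauss_sub hv u z i)
  simp only [ContinuousLinearMap.mul_apply'] at key
  have e1 : ∫ z, f z * (-((z - u) i / v) * gauss v (z - u)) =
      -(1 / v) * ∫ z, gauss v (z - u) * ((z - u) i * f z) := by
    rw [← integral_const_mul]; congr 1; ext z; ring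
  have e2 : ∫ z, f' z * gauss v (z - u) = ∫ z, gauss v (z - u) * f' z := by
    congr 1; ext z; ring
  rw [e1, e2] at key
  rw [neg_mul, neg_inj, one_div, inv_mul_eq_iff_eq_mul₀ hv.ne'] at key
  exact key

lemma integral_gauss_mul_sq_norm (hv : 0 < v) (u : EuclideanSpace ℝ (Fin p)) :
    ∫ z, gauss v (z - u) * ‖z - u‖ ^ 2 = p * v := by
  have hcoord : ∀ z i, |(z - u) i| ≤ ‖z‖ + ‖u‖ := fun z i =>
    (PiLp.norm_apply_le (z - u) i).trans (norm_sub_le _ _)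
  have h : ∀ i : Fin p, ∫ z, gauss v (z - u) * ((z - u) i * (z - u) i) = v := by
    intro i
    -- The variance of one coordinate is Stein's identity for that coordinate function.
    rw [integral_gauss_mul_coord hv u i (f := fun z => (z - u) i) (f' := fun _ => 1)
      (by fun_prop) (by fun_prop) ?_ (1 + ‖u‖) ?_ ?_]
    · simp [integral_gauss_sub hv]
    · intro z
      have := ((hasDerivAt_id (0:ℝ)).const_add (z i)).sub_const (u i)
      simpa [HasLineDerivAt] using this
    · intro z
      nlinarith [hcoord z i, norm_nonneg z, norm_nonneg u, mul_nonneg (norm_nonneg z) (norm_nonneg u)]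
    · intro z
      simp only [abs_one]
      nlinarith [sq_nonneg ‖z‖, norm_nonneg u, mul_nonneg (norm_nonneg u) (sq_nonneg ‖z‖)]
  have e : ∀ z, gauss v (z - u) * ‖z - u‖ ^ 2 =
      ∑ i, gauss v (z - u) * ((z - u) i * (z - u) i) := by
    intro z; rw [← Finset.mul_sum, EuclideanSpace.real_norm_sq_eq]; simp [sq]
  simp_rw [e]
  rw [integral_finsetSum]
  · rw [Finset.sum_congr rfl fun i _ => h i]; simp
  · intro i _
    refine integrable_gauss_smul hv u (by fun_prop) (2 * (1 + ‖u‖) ^ 2) fun z => ?_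
    rw [Real.norm_eq_abs, abs_mul]
    have := hcoord z i
    calc |(z - u) i| * |(z - u) i| ≤ (‖z‖ + ‖u‖) * (‖z‖ + ‖u‖) := by gcongr
      _ ≤ 2 * ‖z‖ ^ 2 + 2 * ‖u‖ ^ 2 := by nlinarith [sq_nonneg (‖z‖ - ‖u‖)]
      _ ≤ _ := by nlinarith [sq_nonneg ‖z‖, norm_nonneg u,
                    mul_nonneg (norm_nonneg u) (sq_nonneg ‖z‖),
                    mul_nonneg (sq_nonneg ‖u‖) (sq_nonneg ‖z‖)]

lemma integral_gauss_smul_self : ∫ z : EuclideanSpace ℝ (Fin p), gauss v z • z = 0 := by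
  have h := integral_neg_eq_self (fun z : EuclideanSpace ℝ (Fin p) => gauss v z • z) volume
  simp only [gauss_neg, smul_neg, integral_neg] at h
  have h2 : (2 : ℝ) • ∫ z : EuclideanSpace ℝ (Fin p), gauss v z • z = 0 := by
    rw [two_smul]; nth_rewrite 1 [← h]; exact neg_add_cancel _
  exact (smul_eq_zero.mp h2).resolve_left two_ne_zero

lemma integral_gauss_sub_smul (hv : 0 < v) (u : EuclideanSpace ℝ (Fin p)) :
    ∫ z, gauss v (z - u) • z = u := by
  have h := integral_sub_right_eq_self (fun z => gauss v z • (z + u)) u (μ := volume)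
  simp only [sub_add_cancel] at h
  rw [h]
  simp_rw [smul_add]
  have h1 : Integrable fun z : EuclideanSpace ℝ (Fin p) => gauss v z • z := by
    have := integrable_gauss_smul hv (0 : EuclideanSpace ℝ (Fin p)) (f := fun z => z)
      (by fun_prop) 1 (fun z => by nlinarith [sq_nonneg (‖z‖ - 1), sq_nonneg ‖z‖])
    simpa using this
  rw [integral_add h1 ((integrable_gauss hv).smul_const u), integral_gauss_smul_self,
    integral_smul_const, integral_gauss hv, one_smul, zero_add]

/-- A quadratic deviation from any point is at least the one from the mean. -/
lemma le_integral_gauss_mul_sq_norm_sub (hv : 0 < v) (u w : EuclideanSpace ℝ (Fin p)) :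
    p * v ≤ ∫ z, gauss v (z - u) * ‖w - z‖ ^ 2 := by
  -- Expansion about the mean `u`; after integration the terms combine to `p v + ‖w - u‖²`.
  have e : ∀ z, gauss v (z - u) * ‖w - z‖ ^ 2 = gauss v (z - u) * ‖z - u‖ ^ 2 +
      (‖w - u‖ ^ 2 + 2 * inner ℝ (w - u) u) * gauss v (z - u)
        - 2 * inner ℝ (w - u) (gauss v (z - u) • z) := by
    intro z
    have : w - z = (w - u) - (z - u) := by abel
    rw [this, norm_sub_sq_real, real_inner_smul_right, inner_sub_right]; ring
  have i1 : Integrable fun z => gauss v (z - u) * ‖z - u‖ ^ 2 := by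
    refine integrable_gauss_smul hv u (by fun_prop) (2 + 2 * ‖u‖ ^ 2) fun z => ?_
    have := norm_sub_le z u
    rw [norm_pow, norm_norm]
    nlinarith [sq_nonneg (‖z‖ - ‖u‖), norm_nonneg (z - u), norm_nonneg z, norm_nonneg u,
      mul_nonneg (sq_nonneg ‖u‖) (sq_nonneg ‖z‖)]
  have i2 : Integrable fun z => gauss v (z - u) • z :=
    integrable_gauss_smul hv u (by fun_prop) 1
      (fun z => by nlinarith [sq_nonneg (‖z‖ - 1), sq_nonneg ‖z‖])
  have i3 : Integrable fun z => gauss v (z - u) := (integrable_gauss hv).comp_sub_right u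
  simp_rw [e]
  have i4 := i1.add (i3.const_mul (‖w - u‖ ^ 2 + 2 * inner ℝ (w - u) u))
  simp only [Pi.add_def] at i4
  rw [integral_sub i4 ((i2.const_inner (𝕜 := ℝ) (w - u)).const_mul 2),
    integral_add i1 (i3.const_mul _), integral_gauss_mul_sq_norm hv, integral_const_mul,
    integral_gauss_sub hv, integral_const_mul, integral_inner i2, integral_gauss_sub_smul hv]
  nlinarith [sq_nonneg ‖w - u‖]

/-- Completing the square in the normal-normal model. -/
lemma gauss_mul_gauss {τ : ℝ} (hτ : 0 < τ) (β y : EuclideanSpace ℝ (Fin p)) :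
    gauss 1 (y - β) * gauss τ β =
      gauss (1 + τ) y * gauss (τ / (1 + τ)) (β - (τ / (1 + τ)) • y) := by
  have h1 : 0 < 1 + τ := by positivity
  have hc : ((2 * Real.pi * 1) ^ (-(p : ℝ) / 2) * (2 * Real.pi * τ) ^ (-(p : ℝ) / 2) : ℝ) =
      (2 * Real.pi * (1 + τ)) ^ (-(p : ℝ) / 2) *
        (2 * Real.pi * (τ / (1 + τ))) ^ (-(p : ℝ) / 2) := by
    rw [← Real.mul_rpow (by positivity) (by positivity),
      ← Real.mul_rpow (by positivity) (by positivity)]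
    congr 1; field_simp
  have he : Real.exp (-‖y - β‖ ^ 2 / (2 * 1)) * Real.exp (-‖β‖ ^ 2 / (2 * τ)) =
      Real.exp (-‖y‖ ^ 2 / (2 * (1 + τ))) *
        Real.exp (-‖β - (τ / (1 + τ)) • y‖ ^ 2 / (2 * (τ / (1 + τ)))) := by
    rw [← Real.exp_add, ← Real.exp_add]
    congr 1
    rw [norm_sub_sq_real, norm_sub_sq_real, real_inner_smul_right, norm_smul,
      Real.norm_of_nonneg (by positivity), real_inner_comm]
    field_simp; ring
  unfold gauss
  calc _ = ((2 * Real.pi * 1) ^ (-(p : ℝ) / 2) * (2 * Real.pi * τ) ^ (-(p : ℝ) / 2)) *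
        (Real.exp (-‖y - β‖ ^ 2 / (2 * 1)) * Real.exp (-‖β‖ ^ 2 / (2 * τ))) := by ring
    _ = _ := by rw [hc, he]; ring

end Gauss

/-! ### Minimax lower bound and Stein's unbiased risk estimate. -/

section Risk

variable {p : ℕ}

lemma risk_eq {δ : EuclideanSpace ℝ (Fin p) → EuclideanSpace ℝ (Fin p)} (hδ : Measurable δ)
    (β : EuclideanSpace ℝ (Fin p)) :
    risk δ β = ∫⁻ y, ENNReal.ofReal (gauss 1 (y - β) * ‖δ y - β‖ ^ 2) := by
  unfold risk gaussianLaw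
  simp_rw [gaussianDensity_eq_gauss]
  rw [lintegral_withDensity_eq_lintegral_mul _ (by fun_prop) (by fun_prop)]
  refine lintegral_congr fun y => ?_
  rw [Pi.mul_apply, ← ENNReal.ofReal_mul (gauss_pos one_pos _).le]

lemma lintegral_gauss_sub {v : ℝ} (hv : 0 < v) (u : EuclideanSpace ℝ (Fin p)) :
    ∫⁻ z, ENNReal.ofReal (gauss v (z - u)) = 1 := by
  rw [← ofReal_integral_eq_lintegral_ofReal ((integrable_gauss hv).comp_sub_right u)
    (.of_forall fun z => (gauss_pos hv _).le), integral_gauss_sub hv, ENNReal.ofReal_one]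

lemma le_lintegral_gauss_mul_sq_norm_sub {v : ℝ} (hv : 0 < v) (u w : EuclideanSpace ℝ (Fin p)) :
    ENNReal.ofReal (p * v) ≤ ∫⁻ z, ENNReal.ofReal (gauss v (z - u) * ‖w - z‖ ^ 2) := by
  rw [← ofReal_integral_eq_lintegral_ofReal]
  · exact ENNReal.ofReal_le_ofReal (le_integral_gauss_mul_sq_norm_sub hv u w)
  · refine integrable_gauss_smul hv u (by fun_prop) (2 + 2 * ‖w‖ ^ 2) fun z => ?_
    have := norm_sub_le w z
    rw [norm_pow, norm_norm]
    nlinarith [sq_nonneg (‖z‖ - ‖w‖), norm_nonneg (w - z), norm_nonneg z, norm_nonneg w,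
      mul_nonneg (sq_nonneg ‖w‖) (sq_nonneg ‖z‖)]
  · exact .of_forall fun z => mul_nonneg (gauss_pos hv _).le (by positivity)

/-- The Bayes risk under the prior `N_p(0, τ I_p)` bounds the maximal risk from below. -/
lemma le_iSup_risk_of_gauss_prior {δ : EuclideanSpace ℝ (Fin p) → EuclideanSpace ℝ (Fin p)}
    (hδ : Measurable δ) {τ : ℝ} (hτ : 0 < τ) :
    ENNReal.ofReal (p * (τ / (1 + τ))) ≤ ⨆ β, risk δ β := by
  have hc : 0 < τ / (1 + τ) := by positivity
  have hτ1 : 0 < 1 + τ := by positivity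
  have h1 : ∫⁻ β, ENNReal.ofReal (gauss τ β) * risk δ β ≤ ⨆ β, risk δ β := by
    calc ∫⁻ β, ENNReal.ofReal (gauss τ β) * risk δ β
        ≤ ∫⁻ β : EuclideanSpace ℝ (Fin p), ENNReal.ofReal (gauss τ β) * ⨆ β, risk δ β :=
          lintegral_mono fun β => mul_le_mul_right (le_iSup (risk δ) β) _
      _ = ⨆ β, risk δ β := by
          rw [lintegral_mul_const _ (by fun_prop)]
          have := lintegral_gauss_sub (p := p) hτ 0
          simp only [sub_zero] at this
          rw [this, one_mul]
  refine le_trans ?_ h1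
  have h2 : ∫⁻ β, ENNReal.ofReal (gauss τ β) * risk δ β =
      ∫⁻ β, ∫⁻ y, ENNReal.ofReal (gauss (1 + τ) y) * ENNReal.ofReal
        (gauss (τ / (1 + τ)) (β - (τ / (1 + τ)) • y) * ‖δ y - β‖ ^ 2) := by
    refine lintegral_congr fun β => ?_
    rw [risk_eq hδ, ← lintegral_const_mul _ (by fun_prop)]
    refine lintegral_congr fun y => ?_
    rw [← ENNReal.ofReal_mul (gauss_pos hτ _).le, ← ENNReal.ofReal_mul (gauss_pos hτ1 _).le,
      ← mul_assoc, ← mul_assoc, ← gauss_mul_gauss hτ, mul_comm (gauss τ β)]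
  -- With `y` outermost, the inner integral is the posterior expected loss under `N_p(0, τ I)`,
  -- which is at least `p τ/(1+τ)` for every `y`.
  rw [h2, lintegral_lintegral_swap (Measurable.aemeasurable (by fun_prop))]
  calc ENNReal.ofReal (p * (τ / (1 + τ)))
      = ∫⁻ y : EuclideanSpace ℝ (Fin p),
          ENNReal.ofReal (gauss (1 + τ) y) * ENNReal.ofReal (p * (τ / (1 + τ))) := by
        rw [lintegral_mul_const _ (by fun_prop)]
        have := lintegral_gauss_sub (p := p) hτ1 0
        simp only [sub_zero] at this
        rw [this, one_mul]
    _ ≤ _ := by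
        refine lintegral_mono fun y => ?_
        rw [lintegral_const_mul _ (by fun_prop)]
        exact mul_le_mul_right (le_lintegral_gauss_mul_sq_norm_sub hc _ _) _

/-- The flat-prior limit `τ → ∞` of the Bayes risks. -/
lemma le_iSup_risk {δ : EuclideanSpace ℝ (Fin p) → EuclideanSpace ℝ (Fin p)}
    (hδ : Measurable δ) : ENNReal.ofReal p ≤ ⨆ β, risk δ β := by
  have ht : Filter.Tendsto (fun τ : ℝ => p * (τ / (1 + τ))) Filter.atTop (nhds (p * 1)) := by
    refine Filter.Tendsto.const_mul _ ?_
    have h : Filter.Tendsto (fun τ : ℝ => 1 - 1 / (1 + τ)) Filter.atTop (nhds (1 - 0)) :=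
      tendsto_const_nhds.sub (tendsto_const_nhds.div_atTop
        (Filter.tendsto_atTop_add_const_left _ 1 Filter.tendsto_id))
    rw [sub_zero] at h
    refine h.congr' ?_
    filter_upwards [Filter.eventually_gt_atTop 0] with τ hτ
    have : 1 + τ ≠ 0 := by positivity
    field_simp; ring
  rw [mul_one] at ht
  refine le_of_tendsto ((ENNReal.continuous_ofReal.tendsto _).comp ht) ?_
  filter_upwards [Filter.eventually_gt_atTop 0] with τ hτ
  exact le_iSup_risk_of_gauss_prior hδ hτ

lemma isMinimax_of_risk_le {δ : EuclideanSpace ℝ (Fin p) → EuclideanSpace ℝ (Fin p)}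
    (hδ : Measurable δ) (h : ∀ β, risk δ β ≤ ENNReal.ofReal p) : IsMinimax δ :=
  ⟨hδ, fun _ hδ' => (iSup_le h).trans (le_iSup_risk hδ')⟩

lemma hasLineDerivAt_shrink_coord {φ φ' : ℝ → ℝ} (hφ : ∀ w, HasDerivAt φ (φ' w) w)
    (z : EuclideanSpace ℝ (Fin p)) (i : Fin p) :
    HasLineDerivAt ℝ (fun z : EuclideanSpace ℝ (Fin p) => φ (‖z‖ ^ 2 / 2) * z i)
      (φ (‖z‖ ^ 2 / 2) + φ' (‖z‖ ^ 2 / 2) * z i ^ 2) z (EuclideanSpace.single i 1) := by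
  have hn : ∀ t : ℝ, ‖z + t • EuclideanSpace.single i (1:ℝ)‖ ^ 2 / 2 =
      ‖z‖ ^ 2 / 2 + t * z i + t ^ 2 / 2 := by
    intro t
    rw [norm_add_sq_real, real_inner_smul_right, EuclideanSpace.inner_single_right, norm_smul]
    simp; ring
  unfold HasLineDerivAt
  simp_rw [hn]
  have h1 : HasDerivAt (fun t : ℝ => ‖z‖ ^ 2 / 2 + t * z i + t ^ 2 / 2) (z i) 0 := by
    have h := (((hasDerivAt_id (0:ℝ)).mul_const (z i)).const_add (‖z‖ ^ 2 / 2)).add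
      (((hasDerivAt_id (0:ℝ)).pow 2).div_const 2)
    convert! h using 1
    simp
  have h2 : HasDerivAt (fun t : ℝ => φ (‖z‖ ^ 2 / 2 + t * z i + t ^ 2 / 2))
      (φ' (‖z‖ ^ 2 / 2) * z i) 0 := by
    have h := hφ (‖z‖ ^ 2 / 2 + 0 * z i + 0 ^ 2 / 2)
    have := h.comp (0:ℝ) h1
    simpa [Function.comp_def] using this
  have h3 : HasDerivAt (fun t : ℝ => (z + t • EuclideanSpace.single i (1:ℝ)) i) 1 0 := by
    simpa using (hasDerivAt_id (0:ℝ)).const_add (z i)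
  convert! h2.mul h3 using 1
  simp; ring

/-- Stein's unbiased estimate of the risk of a shrinkage estimator gives domination of `y`. -/
lemma risk_shrink_le {φ φ' : ℝ → ℝ} (hφ : ∀ w, HasDerivAt φ (φ' w) w) (hφ'c : Continuous φ')
    (hb : ∀ w, 0 ≤ w → |φ w| ≤ 1) (hb' : ∀ w, 0 ≤ w → |φ' w| ≤ 1)
    (hS : ∀ w, 0 ≤ w → w * φ w ^ 2 - p * φ w - 2 * w * φ' w ≤ 0)
    (β : EuclideanSpace ℝ (Fin p)) :
    risk (fun y => (1 - φ (‖y‖ ^ 2 / 2)) • y) β ≤ ENNReal.ofReal p := by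
  have hφc : Continuous φ := continuous_iff_continuousAt.mpr fun w => (hφ w).continuousAt
  have hw : ∀ y : EuclideanSpace ℝ (Fin p), 0 ≤ ‖y‖ ^ 2 / 2 := fun y => by positivity
  have hcoord : ∀ (z : EuclideanSpace ℝ (Fin p)) i, |z i| ≤ ‖z‖ := fun z i => PiLp.norm_apply_le z i
  -- the bounds needed for integrability
  have bf : ∀ i (z : EuclideanSpace ℝ (Fin p)), |φ (‖z‖ ^ 2 / 2) * z i| ≤ 1 * (1 + ‖z‖) := by
    intro i z
    rw [abs_mul]
    nlinarith [hb _ (hw z), hcoord z i, abs_nonneg (z i), abs_nonneg (φ (‖z‖ ^ 2 / 2))]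
  have bf' : ∀ i (z : EuclideanSpace ℝ (Fin p)),
      |φ (‖z‖ ^ 2 / 2) + φ' (‖z‖ ^ 2 / 2) * z i ^ 2| ≤ 1 * (1 + ‖z‖ ^ 2) := by
    intro i z
    refine (abs_add_le _ _).trans ?_
    rw [abs_mul, abs_of_nonneg (sq_nonneg (z i)), ← sq_abs (z i), one_mul]
    have h2 : |z i| ^ 2 ≤ ‖z‖ ^ 2 := by gcongr; exact hcoord z i
    nlinarith [hb _ (hw z), hb' _ (hw z), abs_nonneg (φ' (‖z‖ ^ 2 / 2)), sq_nonneg |z i|]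
  have hcpt : ∀ z : EuclideanSpace ℝ (Fin p), ∀ i, |(z - β) i| ≤ ‖z‖ + ‖β‖ := fun z i =>
    (hcoord (z - β) i).trans (norm_sub_le _ _)
  have stein : ∀ i, ∫ z, gauss 1 (z - β) * ((z - β) i * (φ (‖z‖ ^ 2 / 2) * z i)) =
      ∫ z, gauss 1 (z - β) * (φ (‖z‖ ^ 2 / 2) + φ' (‖z‖ ^ 2 / 2) * z i ^ 2) := by
    intro i
    rw [integral_gauss_mul_coord one_pos β i (by fun_prop) (by fun_prop)
      (fun z => hasLineDerivAt_shrink_coord hφ z i) 1 (bf i) (bf' i), one_mul]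
  have i1 : ∀ i, Integrable fun z => gauss 1 (z - β) * ((z - β) i * (φ (‖z‖ ^ 2 / 2) * z i)) := by
    intro i
    refine integrable_gauss_smul one_pos β (by fun_prop) (2 * (1 + ‖β‖)) fun z => ?_
    rw [Real.norm_eq_abs, abs_mul]
    calc |(z - β) i| * |φ (‖z‖ ^ 2 / 2) * z i| ≤ (‖z‖ + ‖β‖) * (1 * (1 + ‖z‖)) :=
          mul_le_mul (hcpt z i) (bf i z) (abs_nonneg _) (by positivity)
      _ ≤ 2 * (1 + ‖β‖) * (1 + ‖z‖ ^ 2) := by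
          nlinarith [sq_nonneg (‖z‖ - 1), norm_nonneg z, norm_nonneg β,
            mul_nonneg (norm_nonneg β) (sq_nonneg (‖z‖ - 1)),
            mul_nonneg (norm_nonneg β) (sq_nonneg ‖z‖)]
  have i2 : ∀ i, Integrable fun z => gauss 1 (z - β) *
      (φ (‖z‖ ^ 2 / 2) + φ' (‖z‖ ^ 2 / 2) * z i ^ 2) := fun i =>
    integrable_gauss_smul one_pos β (by fun_prop) 1 (bf' i)
  have i3 : Integrable fun z => gauss 1 (z - β) * ‖z - β‖ ^ 2 := by
    refine integrable_gauss_smul one_pos β (by fun_prop) (2 + 2 * ‖β‖ ^ 2) fun z => ?_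
    have := norm_sub_le z β
    rw [norm_pow, norm_norm]
    nlinarith [sq_nonneg (‖z‖ - ‖β‖), norm_nonneg (z - β), norm_nonneg z, norm_nonneg β,
      mul_nonneg (sq_nonneg ‖β‖) (sq_nonneg ‖z‖)]
  have i4 : Integrable fun z => gauss 1 (z - β) * (φ (‖z‖ ^ 2 / 2) ^ 2 * ‖z‖ ^ 2) := by
    refine integrable_gauss_smul one_pos β (by fun_prop) 1 fun z => ?_
    rw [Real.norm_of_nonneg (by positivity), ← sq_abs]
    have : |φ (‖z‖ ^ 2 / 2)| ^ 2 ≤ 1 := pow_le_one₀ (abs_nonneg _) (hb _ (hw z))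
    nlinarith [sq_nonneg ‖z‖]
  have e1 : ∀ z : EuclideanSpace ℝ (Fin p),
      gauss 1 (z - β) * ‖(1 - φ (‖z‖ ^ 2 / 2)) • z - β‖ ^ 2 =
      gauss 1 (z - β) * ‖z - β‖ ^ 2 + gauss 1 (z - β) * (φ (‖z‖ ^ 2 / 2) ^ 2 * ‖z‖ ^ 2)
      - 2 * ∑ i, gauss 1 (z - β) * ((z - β) i * (φ (‖z‖ ^ 2 / 2) * z i)) := by
    intro z
    have h0 : (1 - φ (‖z‖ ^ 2 / 2)) • z - β = (z - β) - φ (‖z‖ ^ 2 / 2) • z := by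
      rw [sub_smul, one_smul]; abel
    have h1 : ∑ i, (z - β) i * (φ (‖z‖ ^ 2 / 2) * z i) =
        inner ℝ (z - β) (φ (‖z‖ ^ 2 / 2) • z) := by
      rw [PiLp.inner_apply]
      exact Finset.sum_congr rfl fun i _ => by simp; ring
    rw [← Finset.mul_sum, h1, h0, norm_sub_sq_real, norm_smul, mul_pow, Real.norm_eq_abs, sq_abs]
    ring
  have e2 : ∀ z : EuclideanSpace ℝ (Fin p),
      ∑ i, gauss 1 (z - β) * (φ (‖z‖ ^ 2 / 2) + φ' (‖z‖ ^ 2 / 2) * z i ^ 2) =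
      gauss 1 (z - β) * (p * φ (‖z‖ ^ 2 / 2) + φ' (‖z‖ ^ 2 / 2) * ‖z‖ ^ 2) := by
    intro z
    rw [← Finset.mul_sum, Finset.sum_add_distrib, ← Finset.mul_sum,
      EuclideanSpace.real_norm_sq_eq]
    simp
  have i5 := integrable_finsetSum Finset.univ fun i _ => i1 i
  have i6 := integrable_finsetSum Finset.univ fun i _ => i2 i
  have i34 := i3.add i4
  simp only [Pi.add_def] at i34
  have hm : Measurable fun y : EuclideanSpace ℝ (Fin p) => (1 - φ (‖y‖ ^ 2 / 2)) • y := by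
    fun_prop
  rw [risk_eq hm, ← ofReal_integral_eq_lintegral_ofReal]
  rotate_left
  · simp_rw [e1]
    exact i34.sub (i5.const_mul 2)
  · exact .of_forall fun z => mul_nonneg (gauss_pos one_pos _).le (by positivity)
  refine ENNReal.ofReal_le_ofReal ?_
  simp_rw [e1]
  -- Stein's identity turns the cross term into the divergence `p φ + φ' ‖z‖²`; the claim is then
  -- the pointwise inequality `hS` integrated.
  rw [integral_sub i34 (i5.const_mul 2), integral_const_mul, integral_finsetSum _ fun i _ => i1 i,
    Finset.sum_congr rfl fun i _ => stein i, ← integral_finsetSum _ fun i _ => i2 i,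
    integral_add i3 i4, integral_gauss_mul_sq_norm one_pos, mul_one]
  have h : ∫ z, gauss 1 (z - β) * (φ (‖z‖ ^ 2 / 2) ^ 2 * ‖z‖ ^ 2) ≤ 2 * ∫ z, ∑ i,
      gauss 1 (z - β) * (φ (‖z‖ ^ 2 / 2) + φ' (‖z‖ ^ 2 / 2) * z i ^ 2) := by
    rw [← integral_const_mul]
    refine integral_mono i4 (i6.const_mul 2) fun z => ?_
    simp only [e2]
    have hs := hS _ (hw z)
    have hg := (gauss_pos one_pos (z - β)).le
    rw [mul_left_comm (2 : ℝ)]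
    refine mul_le_mul_of_nonneg_left ?_ hg
    linarith
  linarith

end Risk

/-! ### Chebyshev's integral inequality. -/

section Chebyshev

/-- Chebyshev's integral inequality with a weight. -/
lemma chebyshev_integral_mul_le {Ω : Type*} [MeasurableSpace Ω] {μ : Measure Ω} {s : Set Ω}
    (hμ : ∀ᵐ x ∂μ, x ∈ s) {f g ρ : Ω → ℝ}
    (hfg : ∀ x ∈ s, ∀ y ∈ s, 0 ≤ (f x - f y) * (g x - g y)) (hρ : ∀ x ∈ s, 0 ≤ ρ x)
    (i0 : Integrable ρ μ) (i1 : Integrable (fun x => f x * ρ x) μ)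
    (i2 : Integrable (fun x => g x * ρ x) μ) (i3 : Integrable (fun x => f x * g x * ρ x) μ) :
    (∫ x, f x * ρ x ∂μ) * ∫ x, g x * ρ x ∂μ ≤ (∫ x, f x * g x * ρ x ∂μ) * ∫ x, ρ x ∂μ := by
  set R := ∫ x, ρ x ∂μ
  set A := ∫ x, f x * ρ x ∂μ
  set B := ∫ x, g x * ρ x ∂μ
  set C := ∫ x, f x * g x * ρ x ∂μ
  -- Symmetrization: the double integral of this nonnegative product is twice the difference of the
  -- two sides.
  have inner_eq : ∀ x, ∫ y, (f x - f y) * (g x - g y) * (ρ x * ρ y) ∂μ =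
      R * (f x * g x * ρ x) - B * (f x * ρ x) - A * (g x * ρ x) + C * ρ x := by
    intro x
    have e : ∀ y, (f x - f y) * (g x - g y) * (ρ x * ρ y) =
        (((f x * g x * ρ x) * ρ y - (f x * ρ x) * (g y * ρ y)) - (g x * ρ x) * (f y * ρ y))
          + ρ x * (f y * g y * ρ y) := by intro y; ring
    simp_rw [e]
    have j1 := (i0.const_mul (f x * g x * ρ x)).sub (i2.const_mul (f x * ρ x))
    have j2 := j1.sub (i1.const_mul (g x * ρ x))
    simp only [Pi.sub_def] at j1 j2
    rw [integral_add j2 (i3.const_mul _), integral_sub j1 (i1.const_mul _),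
      integral_sub (i0.const_mul _) (i2.const_mul _)]
    simp only [integral_const_mul]
    ring
  have h0 : 0 ≤ ∫ x, (R * (f x * g x * ρ x) - B * (f x * ρ x) - A * (g x * ρ x) + C * ρ x) ∂μ := by
    refine integral_nonneg_of_ae ?_
    filter_upwards [hμ] with x hx
    rw [Pi.zero_apply, ← inner_eq]
    refine integral_nonneg_of_ae ?_
    filter_upwards [hμ] with y hy
    exact mul_nonneg (hfg x hx y hy) (mul_nonneg (hρ x hx) (hρ y hy))
  have j1 := (i3.const_mul R).sub (i1.const_mul B)
  have j2 := j1.sub (i2.const_mul A)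
  simp only [Pi.sub_def] at j1 j2
  rw [integral_add j2 (i0.const_mul _), integral_sub j1 (i2.const_mul _),
    integral_sub (i3.const_mul _) (i1.const_mul _)] at h0
  simp only [integral_const_mul] at h0
  change 0 ≤ R * C - B * A - A * B + C * R at h0
  linarith

end Chebyshev

/-- Laplace transform of `f dμ`. -/
noncomputable def laplace (μ : Measure ℝ) (f : ℝ → ℝ) (w : ℝ) : ℝ :=
  ∫ κ, f κ * Real.exp (-(w * κ)) ∂μ

/-! ### Moments of an exponentially tilted measure on `(0,1)`. -/

section Laplace

variable {μ : Measure ℝ}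

lemma laplace_pos (hμ : ∀ᵐ κ ∂μ, κ ∈ Ioo (0 : ℝ) 1) (hμ0 : μ ≠ 0) {f : ℝ → ℝ} {w : ℝ}
    (hf : Integrable (fun κ => f κ * Real.exp (-(w * κ))) μ)
    (hpos : ∀ κ ∈ Ioo (0 : ℝ) 1, 0 < f κ) : 0 < laplace μ f w := by
  unfold laplace
  rw [integral_pos_iff_support_of_nonneg_ae _ hf]
  · have h1 : Function.support (fun κ => f κ * Real.exp (-(w * κ))) =ᵐ[μ] univ := by
      refine Filter.eventuallyEq_univ.mpr ?_
      filter_upwards [hμ] with κ hκ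
      exact (mul_pos (hpos κ hκ) (Real.exp_pos _)).ne'
    rw [measure_congr h1]
    exact Measure.measure_univ_pos.mpr hμ0
  · filter_upwards [hμ] with κ hκ
    exact mul_nonneg (hpos κ hκ).le (Real.exp_pos _).le

variable [IsFiniteMeasure μ]

lemma integrable_laplace (hμ : ∀ᵐ κ ∂μ, κ ∈ Ioo (0 : ℝ) 1) {f : ℝ → ℝ} (hf : Measurable f) (C : ℝ)
    (hC : ∀ κ ∈ Ioo (0 : ℝ) 1, |f κ| ≤ C) (w : ℝ) :
    Integrable (fun κ => f κ * Real.exp (-(w * κ))) μ := by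
  refine Integrable.of_bound (by fun_prop) (C * Real.exp |w|) ?_
  filter_upwards [hμ] with κ hκ
  rw [norm_mul, Real.norm_eq_abs, Real.norm_of_nonneg (Real.exp_pos _).le]
  have h1 := hC κ hκ
  have h2 : -(w * κ) ≤ |w| := by
    have := neg_abs_le (w * κ)
    rw [abs_mul, abs_of_pos hκ.1] at this
    nlinarith [abs_nonneg w, hκ.2]
  exact mul_le_mul h1 (Real.exp_le_exp.mpr h2) (Real.exp_pos _).le ((abs_nonneg _).trans h1)

lemma integrable_laplace_pow (hμ : ∀ᵐ κ ∂μ, κ ∈ Ioo (0 : ℝ) 1) (k : ℕ) (w : ℝ) :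
    Integrable (fun κ => κ ^ k * Real.exp (-(w * κ))) μ :=
  integrable_laplace hμ (by fun_prop) 1
    (fun κ hκ => by rw [abs_pow, abs_of_pos hκ.1]; exact pow_le_one₀ hκ.1.le hκ.2.le) w

lemma hasDerivAt_laplace_pow (hμ : ∀ᵐ κ ∂μ, κ ∈ Ioo (0 : ℝ) 1) (k : ℕ) (w : ℝ) :
    HasDerivAt (laplace μ fun κ => κ ^ k) (-laplace μ (fun κ => κ ^ (k + 1)) w) w := by
  -- A finite measure carried by `(0,1)` has all exponential moments, so its moment generating
  -- function may be differentiated at `-w`.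
  have hset : ProbabilityTheory.integrableExpSet (fun κ : ℝ => κ) μ = univ := by
    refine eq_univ_of_forall fun t => ?_
    have := integrable_laplace_pow hμ 0 (-t)
    simpa [ProbabilityTheory.integrableExpSet] using this
  have h := ProbabilityTheory.hasDerivAt_integral_pow_mul_exp_real (X := fun κ : ℝ => κ) (μ := μ)
    (t := -w) (by rw [hset]; simp) k
  have := h.comp w (hasDerivAt_neg w)
  simp only [Function.comp_def, neg_mul, mul_neg, mul_one] at this
  exact this

lemma laplace_pow_sub (hμ : ∀ᵐ κ ∂μ, κ ∈ Ioo (0 : ℝ) 1) (k : ℕ) (w : ℝ) :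
    laplace μ (fun κ => κ ^ k) w - laplace μ (fun κ => κ ^ (k + 1)) w =
      laplace μ (fun κ => κ ^ k * (1 - κ)) w := by
  unfold laplace
  rw [← integral_sub (integrable_laplace_pow hμ k w) (integrable_laplace_pow hμ (k + 1) w)]
  congr 1; ext κ; ring

lemma laplace_pow_pos (hμ : ∀ᵐ κ ∂μ, κ ∈ Ioo (0 : ℝ) 1) (hμ0 : μ ≠ 0) (k : ℕ) (w : ℝ) :
    0 < laplace μ (fun κ => κ ^ k) w :=
  laplace_pos hμ hμ0 (integrable_laplace_pow hμ k w) fun _ hκ => pow_pos hκ.1 k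

lemma laplace_pow_succ_lt (hμ : ∀ᵐ κ ∂μ, κ ∈ Ioo (0 : ℝ) 1) (hμ0 : μ ≠ 0) (k : ℕ) (w : ℝ) :
    laplace μ (fun κ => κ ^ (k + 1)) w < laplace μ (fun κ => κ ^ k) w := by
  rw [← sub_pos, laplace_pow_sub hμ]
  refine laplace_pos hμ hμ0 ?_ fun _ hκ => mul_pos (pow_pos hκ.1 k) (sub_pos.mpr hκ.2)
  refine ((integrable_laplace_pow hμ k w).sub (integrable_laplace_pow hμ (k + 1) w)).congr ?_
  exact .of_forall fun _ => by simp; ring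

end Laplace

/-! ### A barrier argument for the ratio `w M₂ / M₁`. -/

section Barrier

/-- If `M₁, M₂, M₃` are consecutive moments of a tilted measure satisfying the differential
inequality coming from integration by parts, then `w M₂ / M₁` never exceeds `c / b`. -/
lemma mul_moment_le_of_diff_ineq {M₁ M₂ M₃ : ℝ → ℝ} {b c w₁ : ℝ} (hb : 0 < b) (hb1 : b ≤ 1)
    (hc : 0 < c) (hw₁ : 0 ≤ w₁) (h1 : ∀ w, HasDerivAt M₁ (-M₂ w) w)
    (h2 : ∀ w, HasDerivAt M₂ (-M₃ w) w) (p1 : ∀ w, 0 < M₁ w) (p2 : ∀ w, 0 < M₂ w)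
    (l12 : ∀ w, M₂ w < M₁ w) (l23 : ∀ w, M₃ w < M₂ w)
    (hI : ∀ w, 0 ≤ w → w ≤ w₁ → w * (M₂ w - M₃ w) ≤ c * (M₁ w - M₂ w) - b * M₂ w) :
    b * (w₁ * M₂ w₁) ≤ c * M₁ w₁ := by
  set x : ℝ → ℝ := fun w => w * M₂ w / M₁ w with hx
  set x' : ℝ → ℝ := fun w =>
    ((1 * M₂ w + w * (-M₃ w)) * M₁ w - w * M₂ w * (-M₂ w)) / M₁ w ^ 2 with hx'
  have hd : ∀ w, HasDerivAt x (x' w) w := fun w =>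
    (((hasDerivAt_id w).mul (h2 w)).div (h1 w) (p1 w).ne')
  have hcont : Continuous x := continuous_iff_continuousAt.mpr fun w => (hd w).continuousAt
  -- Above the level `c/b`, inserting `hI` and `w M₂ ≥ (c/b) M₁` bounds the numerator of `x'` by
  -- `-((1-b)/b) M₁ (c (M₁ - M₂) - b M₂)`. The last bracket is nonnegative by `hI` again, and `b ≤
  -- 1` fixes the sign.
  have hneg : ∀ w, 0 ≤ w → w ≤ w₁ → c / b ≤ x w → x' w ≤ 0 := by
    intro w hw hw' hxw
    have hi := hI w hw hw'
    have q1 := p1 w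
    have q2 := p2 w
    have q3 := l12 w
    have q4 := l23 w
    rw [hx, div_le_div_iff₀ hb q1] at hxw
    refine div_nonpos_of_nonpos_of_nonneg ?_ (sq_nonneg _)
    have hbr : b * M₂ w ≤ c * (M₁ w - M₂ w) := by
      have : 0 ≤ w * (M₂ w - M₃ w) := mul_nonneg hw (sub_pos.mpr q4).le
      linarith
    have e : (1 * M₂ w + w * -M₃ w) * M₁ w - w * M₂ w * -M₂ w =
        M₁ w * (M₂ w + w * (M₂ w - M₃ w)) - w * M₂ w * (M₁ w - M₂ w) := by ring
    rw [e]
    have s1 : M₁ w * (M₂ w + w * (M₂ w - M₃ w)) ≤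
        M₁ w * (M₂ w + (c * (M₁ w - M₂ w) - b * M₂ w)) := by gcongr
    have s2 : 0 ≤ (M₁ w - M₂ w) * (w * M₂ w * b - c * M₁ w) :=
      mul_nonneg (sub_pos.mpr q3).le (by linarith)
    have s3 : 0 ≤ (1 - b) * M₁ w * (c * (M₁ w - M₂ w) - b * M₂ w) :=
      mul_nonneg (mul_nonneg (by linarith) q1.le) (by linarith)
    have s4 : b * (M₁ w * (M₂ w + (c * (M₁ w - M₂ w) - b * M₂ w)) -
        w * M₂ w * (M₁ w - M₂ w)) ≤ 0 := by nlinarith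
    have s5 := nonpos_of_mul_nonpos_right s4 hb
    linarith
  suffices h : x w₁ ≤ c / b by
    rw [hx, div_le_div_iff₀ (p1 w₁) hb] at h
    linarith
  by_contra! hcon
  -- After the last point `w₀` where `x ≤ c/b`, the function `x` stays above the level, hence
  -- decreases up to `w₁`. It cannot end above `c/b`.
  set S := {w | w ∈ Icc 0 w₁ ∧ x w ≤ c / b} with hS
  have hSc : IsCompact S := by
    have : S = Icc 0 w₁ ∩ x ⁻¹' Iic (c / b) := rfl
    rw [this]
    exact isCompact_Icc.inter_right (isClosed_Iic.preimage hcont)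
  have hSn : S.Nonempty := ⟨0, ⟨le_rfl, hw₁⟩, by simp [hx]; positivity⟩
  obtain ⟨w₀, ⟨⟨hw0, hw01⟩, hxw0⟩, hmax⟩ := hSc.exists_isGreatest hSn
  have hgt : ∀ w ∈ Ioo w₀ w₁, c / b ≤ x w := by
    intro w hw
    by_contra! hlt
    exact absurd (hmax ⟨⟨hw0.trans hw.1.le, hw.2.le⟩, hlt.le⟩) (not_le.mpr hw.1)
  have hanti : AntitoneOn x (Icc w₀ w₁) := by
    refine antitoneOn_of_deriv_nonpos (convex_Icc _ _) hcont.continuousOn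
      (fun w _ => (hd w).differentiableAt.differentiableWithinAt) fun w hw => ?_
    rw [interior_Icc] at hw
    rw [(hd w).deriv]
    exact hneg w (hw0.trans hw.1.le) hw.2.le (hgt w hw)
  have := hanti ⟨le_rfl, hw01⟩ ⟨hw01, le_rfl⟩ hw01
  linarith

end Barrier

/-! ### Stein's condition for monotone `H`. -/

section SteinCondition

variable {μ : Measure ℝ} [IsFiniteMeasure μ] {H : ℝ → ℝ} {α b P : ℝ}

/-- The identities obtained from `∫ (κ ^ (α + k) (1 - κ) ^ b h(κ) e ^ (-wκ))' dκ = 0`. -/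
def PartsIdentity (μ : Measure ℝ) (H : ℝ → ℝ) (α b : ℝ) : Prop :=
  ∀ (k : ℕ) (w : ℝ),
    w * (laplace μ (fun κ => κ ^ (k + 1)) w - laplace μ (fun κ => κ ^ (k + 2)) w) =
      (α + k) * (laplace μ (fun κ => κ ^ k) w - laplace μ (fun κ => κ ^ (k + 1)) w)
        - b * laplace μ (fun κ => κ ^ (k + 1)) w
        + laplace μ (fun κ => H κ * (κ ^ k * (1 - κ))) w

/-- Stein's condition for the shrinkage coefficient `M₁ / M₀`, as a polynomial inequality. -/
lemma stein_algebra {M₀ M₁ M₂ N₀ α b c w P : ℝ} (hb : 0 < b) (h0 : 0 < M₁) (h01 : M₁ < M₀)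
    (hid : w * (M₁ - M₂) = α * (M₀ - M₁) - b * M₁ + N₀) (hle : b * (w * M₂) ≤ c * M₁)
    (hc : (2 * M₀ - M₁) * c + b * (α + b) * M₁ - b * N₀ ≤ b * (P + α) * M₀) :
    2 * w * M₂ * M₀ - w * M₁ ^ 2 - P * M₁ * M₀ ≤ 0 := by
  -- After this substitution `w M₂` carries the positive coefficient `2 M₀ - M₁`, so its upper bound
  -- `hle` can be inserted.
  have e : w * M₁ ^ 2 = M₁ * (w * M₂ + α * (M₀ - M₁) - b * M₁ + N₀) := by
    linear_combination M₁ * hid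
  have s1 : (2 * M₀ - M₁) * (b * (w * M₂)) ≤ (2 * M₀ - M₁) * (c * M₁) :=
    mul_le_mul_of_nonneg_left hle (by linarith)
  have s2 := mul_le_mul_of_nonneg_left hc h0.le
  have : b * (2 * w * M₂ * M₀ - w * M₁ ^ 2 - P * M₁ * M₀) ≤ 0 := by
    rw [e]; nlinarith
  exact nonpos_of_mul_nonpos_right this hb

/-- Here `0 ≤ H ≤ H 1`: the upper bound gives the barrier constant `c = α + 1 + H 1`, and the term
with `H` in the `k = 0` identity is dropped by its sign. -/
lemma stein_condition_of_monotone (hμ : ∀ᵐ κ ∂μ, κ ∈ Ioo (0 : ℝ) 1) (hμ0 : μ ≠ 0)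
    (hHm : Measurable H) (hH : MonotoneOn H (Icc 0 1)) (hH0 : H 0 = 0) (hα : 0 ≤ α) (hb : 0 < b)
    (hb1 : b ≤ 1) (hid : PartsIdentity μ H α b) (hP : 2 * α + 2 + 2 * H 1 ≤ b * (P + α))
    {w : ℝ} (hw : 0 ≤ w) :
    2 * w * laplace μ (fun κ => κ ^ 2) w * laplace μ (fun κ => κ ^ 0) w
      - w * laplace μ (fun κ => κ ^ 1) w ^ 2
      - P * laplace μ (fun κ => κ ^ 1) w * laplace μ (fun κ => κ ^ 0) w ≤ 0 := by
  have h0 : ∀ κ ∈ Ioo (0 : ℝ) 1, 0 ≤ H κ := fun κ hκ =>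
    hH0 ▸ hH ⟨le_rfl, zero_le_one⟩ ⟨hκ.1.le, hκ.2.le⟩ hκ.1.le
  have h1 : ∀ κ ∈ Ioo (0 : ℝ) 1, H κ ≤ H 1 := fun κ hκ =>
    hH ⟨hκ.1.le, hκ.2.le⟩ ⟨zero_le_one, le_rfl⟩ hκ.2.le
  have hH1 : 0 ≤ H 1 := hH0 ▸ hH ⟨le_rfl, zero_le_one⟩ ⟨zero_le_one, le_rfl⟩ zero_le_one
  have hN0 : 0 ≤ laplace μ (fun κ => H κ * (κ ^ 0 * (1 - κ))) w := by
    refine integral_nonneg_of_ae ?_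
    filter_upwards [hμ] with κ hκ
    exact mul_nonneg (mul_nonneg (h0 κ hκ) (mul_nonneg (by simp) (sub_pos.mpr hκ.2).le))
      (Real.exp_pos _).le
  have hN1 : ∀ w, laplace μ (fun κ => H κ * (κ ^ 1 * (1 - κ))) w ≤
      H 1 * (laplace μ (fun κ => κ ^ 1) w - laplace μ (fun κ => κ ^ 2) w) := by
    intro w
    rw [laplace_pow_sub hμ 1, laplace, laplace, ← integral_const_mul]
    refine integral_mono_ae ?_ ?_ ?_
    · refine integrable_laplace hμ (by fun_prop) (H 1) (fun κ hκ => ?_) w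
      rw [abs_of_nonneg (mul_nonneg (h0 κ hκ) (mul_nonneg (pow_nonneg hκ.1.le _)
        (sub_pos.mpr hκ.2).le))]
      refine (mul_le_mul_of_nonneg_right (h1 κ hκ) (mul_nonneg (pow_nonneg hκ.1.le _)
        (sub_pos.mpr hκ.2).le)).trans (mul_le_of_le_one_right hH1 ?_)
      nlinarith [hκ.1, hκ.2]
    · refine Integrable.const_mul (integrable_laplace hμ (by fun_prop) 1 (fun κ hκ => ?_) w) _
      rw [abs_of_nonneg (mul_nonneg (pow_nonneg hκ.1.le _) (sub_pos.mpr hκ.2).le)]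
      nlinarith [hκ.1, hκ.2]
    · filter_upwards [hμ] with κ hκ
      rw [← mul_assoc (H 1)]
      exact mul_le_mul_of_nonneg_right (mul_le_mul_of_nonneg_right (h1 κ hκ)
        (mul_nonneg (pow_nonneg hκ.1.le _) (sub_pos.mpr hκ.2).le)) (Real.exp_pos _).le
  have hle := mul_moment_le_of_diff_ineq (c := α + 1 + H 1) hb hb1 (by positivity) hw
    (hasDerivAt_laplace_pow hμ 1) (hasDerivAt_laplace_pow hμ 2)
    (laplace_pow_pos hμ hμ0 1) (laplace_pow_pos hμ hμ0 2)
    (laplace_pow_succ_lt hμ hμ0 1) (laplace_pow_succ_lt hμ hμ0 2) fun w _ _ => by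
      have := hid 1 w
      have h := hN1 w
      push_cast at this
      norm_num at this h ⊢
      nlinarith
  have q1 := laplace_pow_pos hμ hμ0 1 w
  have q2 := laplace_pow_succ_lt hμ hμ0 0 w
  refine stein_algebra hb q1 q2 (by simpa using hid 0 w) hle ?_
  norm_num at q1 q2 hN0 ⊢
  have t1 := mul_le_mul_of_nonneg_right hP (q1.trans q2).le
  have t2 : b * (α + b) ≤ α + 1 + H 1 := by nlinarith [mul_nonneg hα (sub_nonneg.mpr hb1)]
  have t3 := mul_le_mul_of_nonneg_right t2 q1.le
  have t4 := mul_nonneg hb.le hN0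
  linarith

/-- Here `H ≤ 0`, so the `k = 0` term has the wrong sign and cannot be dropped. It is compensated by
letting `c` contain the actual mean `N / D` of `H` at the endpoint `w`, which is even more negative
than the mean in the `k = 0` term. -/
lemma stein_condition_of_antitone (hμ : ∀ᵐ κ ∂μ, κ ∈ Ioo (0 : ℝ) 1) (hμ0 : μ ≠ 0)
    (hHm : Measurable H) (hH : AntitoneOn H (Icc 0 1)) (hH0 : H 0 = 0) (hα : 0 ≤ α) (hb : 0 < b)
    (hb1 : b ≤ 1) (hid : PartsIdentity μ H α b) (hP : 2 * α + 2 ≤ b * (P + α))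
    {w : ℝ} (hw : 0 ≤ w) :
    2 * w * laplace μ (fun κ => κ ^ 2) w * laplace μ (fun κ => κ ^ 0) w
      - w * laplace μ (fun κ => κ ^ 1) w ^ 2
      - P * laplace μ (fun κ => κ ^ 1) w * laplace μ (fun κ => κ ^ 0) w ≤ 0 := by
  have h0 : ∀ κ ∈ Ioo (0 : ℝ) 1, H κ ≤ 0 := fun κ hκ =>
    hH0 ▸ hH ⟨le_rfl, zero_le_one⟩ ⟨hκ.1.le, hκ.2.le⟩ hκ.1.le
  have h1 : ∀ κ ∈ Ioo (0 : ℝ) 1, |H κ| ≤ -H 1 := fun κ hκ => by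
    rw [abs_of_nonpos (h0 κ hκ)]
    exact neg_le_neg (hH ⟨hκ.1.le, hκ.2.le⟩ ⟨zero_le_one, le_rfl⟩ hκ.2.le)
  have hk : ∀ (k : ℕ), ∀ κ ∈ Ioo (0 : ℝ) 1, 0 ≤ κ ^ k * (1 - κ) ∧ κ ^ k * (1 - κ) ≤ 1 :=
    fun k κ hκ => ⟨mul_nonneg (pow_nonneg hκ.1.le _) (sub_pos.mpr hκ.2).le,
      mul_le_one₀ (pow_le_one₀ hκ.1.le hκ.2.le) (sub_pos.mpr hκ.2).le (by linarith [hκ.1])⟩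
  have iρ : ∀ (k : ℕ) w, Integrable (fun κ => κ ^ k * (1 - κ) * Real.exp (-(w * κ))) μ := by
    intro k w
    refine integrable_laplace hμ (by fun_prop) 1 (fun κ hκ => ?_) w
    rw [abs_of_nonneg (hk k κ hκ).1]
    exact (hk k κ hκ).2
  have iH : ∀ (k : ℕ) w, Integrable (fun κ => H κ * (κ ^ k * (1 - κ)) * Real.exp (-(w * κ))) μ := by
    intro k w
    refine integrable_laplace hμ (by fun_prop) (-H 1) (fun κ hκ => ?_) w
    rw [abs_mul, abs_of_nonneg (hk k κ hκ).1]
    exact (mul_le_of_le_one_right (abs_nonneg _) (hk k κ hκ).2).trans (h1 κ hκ)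
  -- the weighted mean of `H` increases with `w`
  have cheb_w : ∀ v, v ≤ w → laplace μ (fun κ => H κ * (κ ^ 1 * (1 - κ))) v *
      laplace μ (fun κ => κ ^ 1 * (1 - κ)) w ≤
      laplace μ (fun κ => H κ * (κ ^ 1 * (1 - κ))) w * laplace μ (fun κ => κ ^ 1 * (1 - κ)) v := by
    intro v hv
    have he : ∀ κ, Real.exp (-((w - v) * κ)) * Real.exp (-(v * κ)) = Real.exp (-(w * κ)) := by
      intro κ; rw [← Real.exp_add]; congr 1; ring
    have e1 : ∀ κ, H κ * (κ ^ 1 * (1 - κ) * Real.exp (-(v * κ))) =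
        H κ * (κ ^ 1 * (1 - κ)) * Real.exp (-(v * κ)) := fun κ => by ring
    have e2 : ∀ κ, Real.exp (-((w - v) * κ)) * (κ ^ 1 * (1 - κ) * Real.exp (-(v * κ))) =
        κ ^ 1 * (1 - κ) * Real.exp (-(w * κ)) := fun κ => by rw [← he]; ring
    have e3 : ∀ κ, H κ * Real.exp (-((w - v) * κ)) * (κ ^ 1 * (1 - κ) * Real.exp (-(v * κ))) =
        H κ * (κ ^ 1 * (1 - κ)) * Real.exp (-(w * κ)) := fun κ => by rw [← he]; ring
    -- Passing from tilt `v` to tilt `w` multiplies the weight by `g`, which is non-increasing like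
    -- `H`.
    have := chebyshev_integral_mul_le hμ (f := H) (g := fun κ => Real.exp (-((w - v) * κ)))
      (ρ := fun κ => κ ^ 1 * (1 - κ) * Real.exp (-(v * κ))) ?_ ?_ (iρ 1 v) ?_ ?_ ?_
    · simp only [e1, e2, e3] at this
      exact this
    · have key : ∀ x ∈ Ioo (0 : ℝ) 1, ∀ y ∈ Ioo (0 : ℝ) 1, x ≤ y → 0 ≤ (H x - H y) *
          (Real.exp (-((w - v) * x)) - Real.exp (-((w - v) * y))) := fun x hx y hy hxy =>
        mul_nonneg (sub_nonneg.mpr (hH ⟨hx.1.le, hx.2.le⟩ ⟨hy.1.le, hy.2.le⟩ hxy))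
          (sub_nonneg.mpr (Real.exp_le_exp.mpr (neg_le_neg
            (mul_le_mul_of_nonneg_left hxy (sub_nonneg.mpr hv)))))
      intro x hx y hy
      rcases le_total x y with h | h
      · exact key x hx y hy h
      · linarith [key y hy x hx h]
    · exact fun κ hκ => mul_nonneg (hk 1 κ hκ).1 (Real.exp_pos _).le
    · simpa only [e1] using iH 1 v
    · simpa only [e2] using iρ 1 w
    · simpa only [e3] using iH 1 w
  -- the weighted mean of `H` decreases with the exponent
  have cheb_k : laplace μ (fun κ => H κ * (κ ^ 1 * (1 - κ))) w *
      laplace μ (fun κ => κ ^ 0 * (1 - κ)) w ≤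
      laplace μ (fun κ => H κ * (κ ^ 0 * (1 - κ))) w * laplace μ (fun κ => κ ^ 1 * (1 - κ)) w := by
    have e1 : ∀ κ, -H κ * (κ ^ 0 * (1 - κ) * Real.exp (-(w * κ))) =
        -(H κ * (κ ^ 0 * (1 - κ)) * Real.exp (-(w * κ))) := fun κ => by ring
    have e2 : ∀ κ, κ * (κ ^ 0 * (1 - κ) * Real.exp (-(w * κ))) =
        κ ^ 1 * (1 - κ) * Real.exp (-(w * κ)) := fun κ => by ring
    have e3 : ∀ κ, -H κ * κ * (κ ^ 0 * (1 - κ) * Real.exp (-(w * κ))) =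
        -(H κ * (κ ^ 1 * (1 - κ)) * Real.exp (-(w * κ))) := fun κ => by ring
    have := chebyshev_integral_mul_le hμ (f := fun κ => -H κ) (g := fun κ => κ)
      (ρ := fun κ => κ ^ 0 * (1 - κ) * Real.exp (-(w * κ))) ?_ ?_ (iρ 0 w) ?_ ?_ ?_
    · simp only [e1, e2, e3, integral_neg] at this
      unfold laplace
      linarith
    · have key : ∀ x ∈ Ioo (0 : ℝ) 1, ∀ y ∈ Ioo (0 : ℝ) 1, x ≤ y →
          0 ≤ (-H x - -H y) * (x - y) := fun x hx y hy hxy =>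
        mul_nonneg_of_nonpos_of_nonpos (by
          linarith [hH ⟨hx.1.le, hx.2.le⟩ ⟨hy.1.le, hy.2.le⟩ hxy]) (sub_nonpos.mpr hxy)
      intro x hx y hy
      rcases le_total x y with h | h
      · exact key x hx y hy h
      · linarith [key y hy x hx h]
    · exact fun κ hκ => mul_nonneg (hk 0 κ hκ).1 (Real.exp_pos _).le
    · simp only [e1]
      exact (iH 0 w).neg
    · simpa only [e2] using iρ 1 w
    · simp only [e3]
      exact (iH 1 w).neg
  have hN0 : laplace μ (fun κ => H κ * (κ ^ 0 * (1 - κ))) w ≤ 0 := by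
    refine integral_nonpos_of_ae ?_
    filter_upwards [hμ] with κ hκ
    exact mul_nonpos_of_nonpos_of_nonneg (mul_nonpos_of_nonpos_of_nonneg (h0 κ hκ) (hk 0 κ hκ).1)
      (Real.exp_pos _).le
  have q1 := laplace_pow_pos hμ hμ0 1 w
  have q2 := laplace_pow_succ_lt hμ hμ0 0 w
  have q3 := laplace_pow_pos hμ hμ0 2 w
  have d0 := laplace_pow_sub hμ 0 w
  have dp : ∀ v, 0 < laplace μ (fun κ => κ ^ 1 * (1 - κ)) v := fun v => by
    rw [← laplace_pow_sub hμ 1]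
    exact sub_pos.mpr (laplace_pow_succ_lt hμ hμ0 1 v)
  set N := laplace μ (fun κ => H κ * (κ ^ 1 * (1 - κ))) w with hN
  set D := laplace μ (fun κ => κ ^ 1 * (1 - κ)) w with hD
  have hDp : 0 < D := dp w
  -- The `k = 1` identity itself gives positivity: `(α + 1) D + N = w (M₂ - M₃) + b M₂ > 0`.
  have hcpos : 0 < α + 1 + N / D := by
    have h := hid 1 w
    have hl : 0 ≤ w * (laplace μ (fun κ => κ ^ (1 + 1)) w - laplace μ (fun κ => κ ^ (1 + 2)) w) :=
      mul_nonneg hw (sub_pos.mpr (laplace_pow_succ_lt hμ hμ0 2 w)).le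
    rw [h, laplace_pow_sub hμ 1] at hl
    push_cast at hl
    have : 0 < (α + 1) * D + N := by
      have := mul_pos hb q3
      change 0 ≤ (α + 1) * D - b * laplace μ (fun κ => κ ^ 2) w + N at hl
      linarith
    have e : α + 1 + N / D = ((α + 1) * D + N) / D := by field_simp
    rw [e]; positivity
  have hle := mul_moment_le_of_diff_ineq (c := α + 1 + N / D) hb hb1 hcpos hw
    (hasDerivAt_laplace_pow hμ 1) (hasDerivAt_laplace_pow hμ 2)
    (laplace_pow_pos hμ hμ0 1) (laplace_pow_pos hμ hμ0 2)
    (laplace_pow_succ_lt hμ hμ0 1) (laplace_pow_succ_lt hμ hμ0 2) fun v _ hv => by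
      have h1 := hid 1 v
      have h2 := cheb_w v hv
      have h3 : laplace μ (fun κ => H κ * (κ ^ 1 * (1 - κ))) v ≤
          N / D * laplace μ (fun κ => κ ^ 1 * (1 - κ)) v := by
        rw [div_mul_eq_mul_div, le_div_iff₀ hDp]; exact h2
      rw [← laplace_pow_sub hμ 1] at h3
      push_cast at h1
      norm_num at h1 h3 ⊢
      linarith
  refine stein_algebra hb q1 q2 (by simpa only [Nat.cast_zero, add_zero, zero_add] using hid 0 w) hle ?_
  set M0 := laplace μ (fun κ => κ ^ 0) w
  set M1 := laplace μ (fun κ => κ ^ 1) w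
  set N0 := laplace μ (fun κ => H κ * (κ ^ 0 * (1 - κ))) w
  change M1 < M0 at q2
  change M0 - M1 = _ at d0
  rw [← d0] at cheb_k
  have hd : 0 < M0 - M1 := sub_pos.mpr q2
  -- `-n` is the mean of `H` with weight `(1-κ) e^(-wκ)`; by `cheb_k` it dominates `N / D`.
  obtain ⟨n, hn⟩ : ∃ n, n = -N0 / (M0 - M1) := ⟨_, rfl⟩
  have hn0 : 0 ≤ n := hn ▸ div_nonneg (by linarith) hd.le
  have hN0n : N0 = -n * (M0 - M1) := by rw [hn]; field_simp
  have hND : N / D ≤ -n := by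
    rw [hn, neg_div, neg_neg, div_le_div_iff₀ hDp hd]; exact cheb_k
  rw [hN0n]
  have t1 : (2 * M0 - M1) * (α + 1 + N / D) ≤ (2 * M0 - M1) * (α + 1 - n) :=
    mul_le_mul_of_nonneg_left (by linarith) (by linarith)
  have t2 := mul_le_mul_of_nonneg_right hP (q1.trans q2).le
  have t3 : b * (α + b) * M1 ≤ (α + 1) * M1 := by
    refine mul_le_mul_of_nonneg_right ?_ q1.le
    nlinarith [mul_nonneg hα (sub_nonneg.mpr hb1)]
  -- The net contribution of `n`: `2 M0 - M1` from `c`, minus `b (M0 - M1)` from `N0`.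
  have t4 : 0 ≤ n * (M0 + (1 - b) * (M0 - M1)) :=
    mul_nonneg hn0 (add_nonneg (q1.trans q2).le (mul_nonneg (by linarith) hd.le))
  linarith

end SteinCondition

/-! ### Gaussian mixtures over `κ` and their means. -/

section Mixture

variable {p : ℕ}

@[fun_prop]
lemma measurable_gauss_uncurry :
    Measurable fun x : ℝ × EuclideanSpace ℝ (Fin p) => gauss x.1 x.2 := by
  unfold gauss; fun_prop

/-- The crude bound `‖z‖ ≤ 1 + ‖u‖ + ‖z - u‖²` suffices; what matters is uniformity as the variance
`1 - κ` tends to `0`. -/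
lemma integral_gauss_sub_mul_norm_le {v : ℝ} (hv : 0 < v) (u : EuclideanSpace ℝ (Fin p)) :
    ∫ z, gauss v (z - u) * ‖z‖ ≤ 1 + ‖u‖ + p * v := by
  have i0 : Integrable fun z => gauss v (z - u) := (integrable_gauss hv).comp_sub_right u
  have i1 : Integrable fun z => gauss v (z - u) * ‖z - u‖ ^ 2 := by
    refine integrable_gauss_smul hv u (by fun_prop) (2 + 2 * ‖u‖ ^ 2) fun z => ?_
    have := norm_sub_le z u
    rw [norm_pow, norm_norm]
    nlinarith [sq_nonneg (‖z‖ - ‖u‖), norm_nonneg (z - u), norm_nonneg z, norm_nonneg u,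
      mul_nonneg (sq_nonneg ‖u‖) (sq_nonneg ‖z‖)]
  have i2 : Integrable fun z => gauss v (z - u) * ‖z‖ :=
    integrable_gauss_smul hv u (by fun_prop) 1
      (fun z => by rw [norm_norm]; nlinarith [sq_nonneg (‖z‖ - 1), sq_nonneg ‖z‖])
  calc ∫ z, gauss v (z - u) * ‖z‖
      ≤ ∫ z, ((1 + ‖u‖) * gauss v (z - u) + gauss v (z - u) * ‖z - u‖ ^ 2) := by
        refine integral_mono i2 ((i0.const_mul _).add i1) fun z => ?_
        have h1 : ‖z‖ ≤ ‖z - u‖ + ‖u‖ := by simpa using norm_add_le (z - u) u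
        have h2 : ‖z‖ ≤ 1 + ‖u‖ + ‖z - u‖ ^ 2 := by nlinarith [sq_nonneg (‖z - u‖ - 1)]
        have := mul_le_mul_of_nonneg_left h2 (gauss_pos hv (z - u)).le
        change gauss v (z - u) * ‖z‖ ≤ _
        linarith
    _ = _ := by
        rw [integral_add (i0.const_mul _) i1, integral_const_mul, integral_gauss_sub hv,
          integral_gauss_mul_sq_norm hv, mul_one]

variable {r : ℝ → ℝ} (y : EuclideanSpace ℝ (Fin p))

/-- Density of the mixture of `N_p((1 - κ) y, (1 - κ) I_p)` with weight `r κ` on `(0, 1)`. -/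
noncomputable def mixture (r : ℝ → ℝ) (y β : EuclideanSpace ℝ (Fin p)) : ℝ≥0∞ :=
  ∫⁻ κ in Ioo (0 : ℝ) 1, ENNReal.ofReal (r κ * gauss (1 - κ) (β - (1 - κ) • y))

lemma measurable_mixture_kernel (hr : Measurable r) :
    Measurable fun x : EuclideanSpace ℝ (Fin p) × ℝ =>
      r x.2 * gauss (1 - x.2) (x.1 - (1 - x.2) • y) := by
  have : Measurable fun x : EuclideanSpace ℝ (Fin p) × ℝ =>
      gauss (1 - x.2) (x.1 - (1 - x.2) • y) :=
    measurable_gauss_uncurry.comp (f := fun x : EuclideanSpace ℝ (Fin p) × ℝ =>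
      (1 - x.2, x.1 - (1 - x.2) • y)) (by fun_prop)
  fun_prop

lemma measurable_mixture (hr : Measurable r) : Measurable (mixture r y) :=
  (measurable_mixture_kernel y hr).ennreal_ofReal.lintegral_prod_right'

lemma lintegral_mixture (hr : Measurable r) (hr0 : ∀ κ ∈ Ioo (0 : ℝ) 1, 0 ≤ r κ)
    (hri : IntegrableOn r (Ioo 0 1)) :
    ∫⁻ β, mixture r y β = ENNReal.ofReal (∫ κ in Ioo (0 : ℝ) 1, r κ) := by
  unfold mixture
  rw [lintegral_lintegral_swap (measurable_mixture_kernel y hr).ennreal_ofReal.aemeasurable,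
    ofReal_integral_eq_lintegral_ofReal hri
      ((ae_restrict_iff' measurableSet_Ioo).mpr (.of_forall hr0))]
  refine setLIntegral_congr_fun measurableSet_Ioo fun κ hκ => ?_
  simp_rw [ENNReal.ofReal_mul (hr0 κ hκ)]
  rw [lintegral_const_mul _ (by fun_prop), lintegral_gauss_sub (sub_pos.mpr hκ.2), mul_one]

lemma toReal_mixture (hr : Measurable r) (hr0 : ∀ κ ∈ Ioo (0 : ℝ) 1, 0 ≤ r κ)
    (β : EuclideanSpace ℝ (Fin p)) :
    (mixture r y β).toReal =
      ∫ κ in Ioo (0 : ℝ) 1, r κ * gauss (1 - κ) (β - (1 - κ) • y) := by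
  rw [mixture, integral_eq_lintegral_of_nonneg_ae]
  · exact (ae_restrict_iff' measurableSet_Ioo).mpr (.of_forall fun κ hκ =>
      mul_nonneg (hr0 κ hκ) (gauss_pos (sub_pos.mpr hκ.2) _).le)
  · exact ((measurable_mixture_kernel y hr).comp
      (measurable_prodMk_left (x := β))).aestronglyMeasurable

/-- Justifies Fubini for the mean: for each `κ` the first absolute moment is at most `1 + ‖y‖ + p`.
-/
lemma integrable_mixture_kernel_smul (hr : Measurable r) (hr0 : ∀ κ ∈ Ioo (0 : ℝ) 1, 0 ≤ r κ)
    (hri : IntegrableOn r (Ioo 0 1)) :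
    Integrable (fun x : EuclideanSpace ℝ (Fin p) × ℝ =>
      (r x.2 * gauss (1 - x.2) (x.1 - (1 - x.2) • y)) • x.1)
      (volume.prod (volume.restrict (Ioo 0 1))) := by
  have hm : AEStronglyMeasurable (fun x : EuclideanSpace ℝ (Fin p) × ℝ =>
      (r x.2 * gauss (1 - x.2) (x.1 - (1 - x.2) • y)) • x.1)
      (volume.prod (volume.restrict (Ioo 0 1))) :=
    ((measurable_mixture_kernel y hr).smul measurable_fst).aestronglyMeasurable
  rw [integrable_prod_iff' hm]
  constructor
  · refine (ae_restrict_iff' measurableSet_Ioo).mpr (.of_forall fun κ hκ => ?_)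
    have := (integrable_gauss_smul (sub_pos.mpr hκ.2) ((1 - κ) • y) (f := fun β => β)
      (by fun_prop) 1 (fun z => by nlinarith [sq_nonneg (‖z‖ - 1), sq_nonneg ‖z‖])).smul (r κ)
    simpa [mul_smul, Pi.smul_def] using this
  · refine Integrable.mono' (hri.mul_const (1 + ‖y‖ + p)) hm.norm.prod_swap.integral_prod_right' ?_
    refine (ae_restrict_iff' measurableSet_Ioo).mpr (.of_forall fun κ hκ => ?_)
    have hv : 0 < 1 - κ := sub_pos.mpr hκ.2
    rw [Real.norm_of_nonneg (integral_nonneg fun _ => norm_nonneg _)]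
    have e : ∀ β : EuclideanSpace ℝ (Fin p),
        ‖(r κ * gauss (1 - κ) (β - (1 - κ) • y)) • β‖ =
          r κ * (gauss (1 - κ) (β - (1 - κ) • y) * ‖β‖) := fun β => by
      rw [norm_smul, Real.norm_of_nonneg (mul_nonneg (hr0 κ hκ) (gauss_pos hv _).le), mul_assoc]
    simp_rw [e]
    rw [integral_const_mul]
    refine mul_le_mul_of_nonneg_left ((integral_gauss_sub_mul_norm_le hv _).trans ?_) (hr0 κ hκ)
    rw [norm_smul, Real.norm_of_nonneg hv.le]
    have h1 : (1 - κ) * ‖y‖ ≤ ‖y‖ :=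
      mul_le_of_le_one_left (norm_nonneg _) (by linarith [hκ.1])
    have h2 : (p : ℝ) * (1 - κ) ≤ p := mul_le_of_le_one_right (by positivity) (by linarith [hκ.1])
    linarith

lemma ae_mixture_lt_top (hr : Measurable r) (hr0 : ∀ κ ∈ Ioo (0 : ℝ) 1, 0 ≤ r κ)
    (hri : IntegrableOn r (Ioo 0 1)) : ∀ᵐ β, mixture r y β < ∞ :=
  ae_lt_top (measurable_mixture y hr) (by rw [lintegral_mixture y hr hr0 hri]; simp)

lemma integrable_withDensity_mixture (hr : Measurable r) (hr0 : ∀ κ ∈ Ioo (0 : ℝ) 1, 0 ≤ r κ)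
    (hri : IntegrableOn r (Ioo 0 1)) :
    Integrable (fun β => β) (volume.withDensity (mixture r y)) := by
  rw [integrable_withDensity_iff_integrable_smul' (measurable_mixture y hr)
    (ae_mixture_lt_top y hr hr0 hri)]
  refine (integrable_mixture_kernel_smul y hr hr0 hri).integral_prod_left.congr
    (.of_forall fun β => ?_)
  simp only [toReal_mixture y hr hr0]
  rw [integral_smul_const]

lemma integral_withDensity_mixture (hr : Measurable r) (hr0 : ∀ κ ∈ Ioo (0 : ℝ) 1, 0 ≤ r κ)
    (hri : IntegrableOn r (Ioo 0 1)) :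
    ∫ β, β ∂(volume.withDensity (mixture r y)) =
      (∫ κ in Ioo (0 : ℝ) 1, r κ * (1 - κ)) • y := by
  rw [integral_withDensity_eq_integral_toReal_smul (measurable_mixture y hr)
    (ae_mixture_lt_top y hr hr0 hri)]
  simp_rw [toReal_mixture y hr hr0, ← integral_smul_const]
  rw [integral_integral_swap (integrable_mixture_kernel_smul y hr hr0 hri)]
  refine setIntegral_congr_fun measurableSet_Ioo fun κ hκ => ?_
  simp_rw [mul_smul]
  rw [integral_smul, integral_gauss_sub_smul (sub_pos.mpr hκ.2)]

end Mixture

/-! ### The posterior of `β` as a mixture. -/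

section Posterior

variable {p : ℕ} {q : ℝ → ℝ}

/-- The weight `κ ^ (p/2) e ^ (-κ ‖y‖²/2) q(κ)` of `κ` given `y`, with its normalising constant. -/
noncomputable def kappaWeight (q : ℝ → ℝ) (y : EuclideanSpace ℝ (Fin p)) (κ : ℝ) : ℝ :=
  (2 * Real.pi) ^ (-(p : ℝ) / 2) * (κ ^ ((p : ℝ) / 2) * Real.exp (-κ * (‖y‖ ^ 2 / 2)) * q κ)

/-- Complete the square with `τ = (1-κ)/κ`: then `1 + τ = 1/κ` is the variance of `y` given `κ`, and
`τ/(1+τ) = 1 - κ` is both the shrinkage factor and the posterior variance. -/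
lemma gaussianDensity_mul_priorBeta (hq : Measurable q) (y β : EuclideanSpace ℝ (Fin p)) :
    ENNReal.ofReal (gaussianDensity β y) * priorBeta q β = mixture (kappaWeight q y) y β := by
  unfold priorBeta mixture
  rw [← lintegral_const_mul _ (by fun_prop)]
  refine setLIntegral_congr_fun measurableSet_Ioo fun κ hκ => ?_
  have h0 : 0 < κ := hκ.1
  have h1 : 0 < 1 - κ := sub_pos.mpr hκ.2
  have hτ : 0 < (1 - κ) / κ := by positivity
  rw [gaussianDensity_eq_gauss, ← ENNReal.ofReal_mul (gauss_pos one_pos _).le]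
  congr 1
  have e1 : (2 * Real.pi) ^ (-(p : ℝ) / 2) * (κ / (1 - κ)) ^ ((p : ℝ) / 2) *
      Real.exp (-(κ / (1 - κ)) * (‖β‖ ^ 2 / 2)) = gauss ((1 - κ) / κ) β := by
    unfold gauss
    rw [Real.mul_rpow (by positivity) hτ.le, neg_div, Real.rpow_neg hτ.le,
      ← Real.inv_rpow hτ.le, inv_div]
    congr 2
    field_simp
  have e2 : gauss (1 + (1 - κ) / κ) y =
      (2 * Real.pi) ^ (-(p : ℝ) / 2) * (κ ^ ((p : ℝ) / 2) * Real.exp (-κ * (‖y‖ ^ 2 / 2))) := by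
    have : 1 + (1 - κ) / κ = κ⁻¹ := by field_simp; ring
    unfold gauss
    rw [this, Real.mul_rpow (by positivity) (by positivity), neg_div,
      Real.rpow_neg (inv_nonneg.mpr h0.le), ← Real.inv_rpow (inv_nonneg.mpr h0.le), inv_inv,
      mul_assoc]
    congr 3
    field_simp
  have e3 : (1 - κ) / κ / (1 + (1 - κ) / κ) = 1 - κ := by field_simp; ring
  rw [e1, ← mul_assoc, gauss_mul_gauss hτ, e2, e3]
  unfold kappaWeight
  ring

lemma marginal_eq (hq : Measurable q) (hq0 : ∀ κ ∈ Ioo (0 : ℝ) 1, 0 ≤ q κ)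
    (y : EuclideanSpace ℝ (Fin p)) (hi : IntegrableOn (kappaWeight q y) (Ioo 0 1)) :
    marginal q y = ENNReal.ofReal (∫ κ in Ioo (0 : ℝ) 1, kappaWeight q y κ) := by
  unfold marginal
  simp_rw [gaussianDensity_mul_priorBeta hq]
  refine lintegral_mixture y (by unfold kappaWeight; fun_prop) (fun κ hκ => ?_) hi
  have := hq0 κ hκ
  have := hκ.1
  unfold kappaWeight; positivity

lemma integrable_integral_posterior (hq : Measurable q) (hq0 : ∀ κ ∈ Ioo (0 : ℝ) 1, 0 ≤ q κ)
    (y : EuclideanSpace ℝ (Fin p)) (hi : IntegrableOn (kappaWeight q y) (Ioo 0 1))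
    (hpos : 0 < ∫ κ in Ioo (0 : ℝ) 1, kappaWeight q y κ) :
    Integrable (fun β => β) (posterior q y) ∧
      ∫ β, β ∂(posterior q y) = ((∫ κ in Ioo (0 : ℝ) 1, kappaWeight q y κ * (1 - κ)) /
        ∫ κ in Ioo (0 : ℝ) 1, kappaWeight q y κ) • y := by
  have hm : Measurable (kappaWeight q y) := by unfold kappaWeight; fun_prop
  have hn : ∀ κ ∈ Ioo (0 : ℝ) 1, 0 ≤ kappaWeight q y κ := fun κ hκ => by
    have := hq0 κ hκ
    have := hκ.1
    unfold kappaWeight; positivity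
  have e : posterior q y = (marginal q y)⁻¹ • volume.withDensity (mixture (kappaWeight q y) y) := by
    unfold posterior
    simp_rw [gaussianDensity_mul_priorBeta hq]
  have h0 : marginal q y ≠ 0 := by
    rw [marginal_eq hq hq0 y hi]; simpa using hpos
  rw [e]
  refine ⟨(integrable_withDensity_mixture y hm hn hi).smul_measure (ENNReal.inv_ne_top.mpr h0), ?_⟩
  rw [integral_smul_measure, integral_withDensity_mixture y hm hn hi, marginal_eq hq hq0 y hi,
    ENNReal.toReal_inv, ENNReal.toReal_ofReal hpos.le, smul_smul, div_eq_inv_mul]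

end Posterior

/-! ### The measure on `κ` and integration by parts. -/

section KappaMeasure

/-- The measure `κ ^ (α - 1) (1 - κ) ^ (b - 1) h(κ) dκ` on `(0, 1)`. -/
noncomputable def kappaMeasure (α b : ℝ) (h : ℝ → ℝ) : Measure ℝ :=
  (volume.restrict (Ioo 0 1)).withDensity fun κ => ENNReal.ofReal (priorKappa α b h κ)

variable {α b : ℝ} {h : ℝ → ℝ}

@[fun_prop]
lemma measurable_priorKappa (hm : Measurable h) : Measurable (priorKappa α b h) := by
  unfold priorKappa; fun_prop

lemma priorKappa_pos (hpos : ∀ κ ∈ Icc (0 : ℝ) 1, 0 < h κ) :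
    ∀ κ ∈ Ioo (0 : ℝ) 1, 0 < priorKappa α b h κ := fun κ hκ =>
  mul_pos (mul_pos (Real.rpow_pos_of_pos hκ.1 _) (Real.rpow_pos_of_pos (sub_pos.mpr hκ.2) _))
    (hpos κ ⟨hκ.1.le, hκ.2.le⟩)

lemma rpow_mul_priorKappa (s : ℝ) {κ : ℝ} (hκ : 0 < κ) :
    κ ^ s * priorKappa α b h κ = priorKappa (s + α) b h κ := by
  unfold priorKappa
  rw [add_sub_assoc, Real.rpow_add hκ]; ring

lemma integrableOn_rpow_mul_one_sub_rpow (hα : 0 < α) (hb : 0 < b) :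
    IntegrableOn (fun κ : ℝ => κ ^ (α - 1) * (1 - κ) ^ (b - 1)) (Ioo 0 1) := by
  -- On `(0,1)` the complex Beta integrand is real, so its real part is the function in question.
  have h1 := Complex.betaIntegral_convergent (u := α) (v := b) (by simpa) (by simpa)
  rw [intervalIntegrable_iff_integrableOn_Ioo_of_le zero_le_one] at h1
  refine (Integrable.re h1).congr
    ((ae_restrict_iff' measurableSet_Ioo).mpr (.of_forall fun κ hκ => ?_))
  have e1 : (κ : ℂ) ^ ((α : ℂ) - 1) = ((κ ^ (α - 1) : ℝ) : ℂ) := by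
    rw [Complex.ofReal_cpow hκ.1.le]; simp
  have e2 : (1 - (κ : ℂ)) ^ ((b : ℂ) - 1) = (((1 - κ) ^ (b - 1) : ℝ) : ℂ) := by
    rw [Complex.ofReal_cpow (sub_pos.mpr hκ.2).le]; simp
  simp only [e1, e2, ← Complex.ofReal_mul]
  simp

lemma integrableOn_priorKappa (hα : 0 < α) (hb : 0 < b) (hm : Measurable h)
    (hc : ContinuousOn h (Icc 0 1)) : IntegrableOn (priorKappa α b h) (Ioo 0 1) := by
  obtain ⟨C, hC⟩ := isCompact_Icc.exists_bound_of_continuousOn hc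
  exact Integrable.mul_bdd (c := C) (integrableOn_rpow_mul_one_sub_rpow hα hb)
    hm.aestronglyMeasurable <| (ae_restrict_iff' measurableSet_Ioo).mpr
    (.of_forall fun κ hκ => hC κ ⟨hκ.1.le, hκ.2.le⟩)

lemma isFiniteMeasure_kappaMeasure (hα : 0 < α) (hb : 0 < b) (hm : Measurable h)
    (hc : ContinuousOn h (Icc 0 1)) : IsFiniteMeasure (kappaMeasure α b h) :=
  isFiniteMeasure_withDensity_ofReal (integrableOn_priorKappa hα hb hm hc).2

lemma ae_mem_Ioo_kappaMeasure : ∀ᵐ κ ∂(kappaMeasure α b h), κ ∈ Ioo (0 : ℝ) 1 :=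
  (withDensity_absolutelyContinuous _ _).ae_le (ae_restrict_mem measurableSet_Ioo)

lemma kappaMeasure_ne_zero (hm : Measurable h) (hpos : ∀ κ ∈ Icc (0 : ℝ) 1, 0 < h κ) :
    kappaMeasure α b h ≠ 0 := by
  intro h0
  unfold kappaMeasure at h0
  rw [withDensity_eq_zero_iff (by fun_prop), Filter.EventuallyEq,
    ae_restrict_iff' measurableSet_Ioo] at h0
  have : (volume : Measure ℝ) (Ioo 0 1) = 0 := by
    refine measure_mono_null (fun κ hκ => ?_) h0
    simpa [hκ.1, hκ.2] using priorKappa_pos (α := α) (b := b) hpos κ hκ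
  simp at this

lemma integrable_kappaMeasure_iff (hm : Measurable h) (hpos : ∀ κ ∈ Icc (0 : ℝ) 1, 0 < h κ)
    {g : ℝ → ℝ} : Integrable g (kappaMeasure α b h) ↔
      IntegrableOn (fun κ => priorKappa α b h κ * g κ) (Ioo 0 1) := by
  unfold kappaMeasure
  rw [integrable_withDensity_iff_integrable_smul' (by fun_prop) (by simp)]
  refine integrable_congr ((ae_restrict_iff' measurableSet_Ioo).mpr (.of_forall fun κ hκ => ?_))
  simp [ENNReal.toReal_ofReal (priorKappa_pos hpos κ hκ).le]

lemma integral_kappaMeasure (hm : Measurable h) (hpos : ∀ κ ∈ Icc (0 : ℝ) 1, 0 < h κ)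
    (g : ℝ → ℝ) : ∫ κ, g κ ∂(kappaMeasure α b h) =
      ∫ κ in Ioo (0 : ℝ) 1, priorKappa α b h κ * g κ := by
  unfold kappaMeasure
  rw [integral_withDensity_eq_integral_toReal_smul (by fun_prop) (by simp)]
  refine setIntegral_congr_fun measurableSet_Ioo fun κ hκ => ?_
  simp [ENNReal.toReal_ofReal (priorKappa_pos hpos κ hκ).le]

lemma partsIdentity_kappaMeasure (hα : 0 < α) (hb : 0 < b) (hm : Measurable h)
    (hc : ContinuousOn h (Icc 0 1)) (hpos : ∀ κ ∈ Icc (0 : ℝ) 1, 0 < h κ)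
    (hd : ∀ κ ∈ Ioo (0 : ℝ) 1, DifferentiableAt ℝ h κ) {C : ℝ}
    (hC : ∀ κ ∈ Ioo (0 : ℝ) 1, |logSlope h κ| ≤ C) :
    PartsIdentity (kappaMeasure α b h) (logSlope h) α b := by
  intro k w
  have := isFiniteMeasure_kappaMeasure hα hb hm hc
  have hμ := ae_mem_Ioo_kappaMeasure (α := α) (b := b) (h := h)
  set μ := kappaMeasure α b h with hμdef
  have hHm : Measurable (logSlope h) := by
    have := measurable_deriv h
    unfold logSlope; fun_prop
  have iM := fun j => integrable_laplace_pow hμ j w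
  have iN : Integrable (fun κ => logSlope h κ * (κ ^ k * (1 - κ)) * Real.exp (-(w * κ))) μ := by
    refine integrable_laplace hμ (by fun_prop) C (fun κ hκ => ?_) w
    have h1 : |κ ^ k * (1 - κ)| ≤ 1 := by
      rw [abs_of_nonneg (mul_nonneg (pow_nonneg hκ.1.le _) (sub_pos.mpr hκ.2).le)]
      exact mul_le_one₀ (pow_le_one₀ hκ.1.le hκ.2.le) (sub_pos.mpr hκ.2).le (by linarith [hκ.1])
    rw [abs_mul]
    exact (mul_le_of_le_one_right (abs_nonneg _) h1).trans (hC κ hκ)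
  set G : ℝ → ℝ := fun κ =>
    ((α + k) * (κ ^ k * Real.exp (-(w * κ)) - κ ^ (k + 1) * Real.exp (-(w * κ)))
      - b * (κ ^ (k + 1) * Real.exp (-(w * κ)))
      + logSlope h κ * (κ ^ k * (1 - κ)) * Real.exp (-(w * κ)))
      - w * (κ ^ (k + 1) * Real.exp (-(w * κ)) - κ ^ (k + 2) * Real.exp (-(w * κ))) with hG
  have i1 := ((iM k).sub (iM (k + 1))).const_mul (α + k)
  have i2 := i1.sub ((iM (k + 1)).const_mul b)
  have i3 := i2.add iN
  have i4 := ((iM (k + 1)).sub (iM (k + 2))).const_mul w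
  have iG : Integrable G μ := i3.sub i4
  have hGint : ∫ κ, G κ ∂μ =
      ((α + k) * (laplace μ (fun κ => κ ^ k) w - laplace μ (fun κ => κ ^ (k + 1)) w)
        - b * laplace μ (fun κ => κ ^ (k + 1)) w
        + laplace μ (fun κ => logSlope h κ * (κ ^ k * (1 - κ))) w)
      - w * (laplace μ (fun κ => κ ^ (k + 1)) w - laplace μ (fun κ => κ ^ (k + 2)) w) := by
    simp only [Pi.sub_def, Pi.add_def] at i1 i2 i3 i4
    rw [hG, integral_sub i3 i4, integral_add i2 iN,
      integral_sub i1 ((iM (k + 1)).const_mul b), integral_const_mul, integral_const_mul,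
      integral_const_mul, integral_sub (iM k) (iM (k + 1)),
      integral_sub (iM (k + 1)) (iM (k + 2))]
    rfl
  have hzero : ∫ κ, G κ ∂μ = 0 := by
    rw [hμdef, integral_kappaMeasure hm hpos]
    have hint := (integrable_kappaMeasure_iff hm hpos).mp iG
    rw [← integral_Ioc_eq_integral_Ioo, ← intervalIntegral.integral_of_le zero_le_one]
    have hαk : 0 < α + k := by positivity
    -- The density times `G` is the derivative of this primitive, whose boundary values vanish
    -- because `α + k > 0` and `b > 0`.
    rw [intervalIntegral.integral_eq_sub_of_hasDerivAt_of_le zero_le_one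
      (f := fun κ => κ ^ (α + k) * (1 - κ) ^ b * h κ * Real.exp (-(w * κ)))]
    · simp [Real.zero_rpow hαk.ne', Real.zero_rpow hb.ne']
    · refine ContinuousOn.mul (ContinuousOn.mul (ContinuousOn.mul ?_ ?_) hc) (by fun_prop)
      · exact (continuous_id.rpow_const fun _ => Or.inr hαk.le).continuousOn
      · exact ((continuous_const.sub continuous_id).rpow_const fun _ => Or.inr hb.le).continuousOn
    · intro κ hκ
      have h0 : κ ≠ 0 := hκ.1.ne'
      have h1 : 1 - κ ≠ 0 := (sub_pos.mpr hκ.2).ne'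
      have hh : h κ ≠ 0 := (hpos κ ⟨hκ.1.le, hκ.2.le⟩).ne'
      have D1 := Real.hasDerivAt_rpow_const (x := κ) (p := α + k) (Or.inl h0)
      have D2 := ((hasDerivAt_id κ).const_sub 1).rpow_const (p := b) (Or.inl h1)
      have D3 := (hd κ hκ).hasDerivAt
      have D4 := (((hasDerivAt_id κ).const_mul w).neg).exp
      refine (((D1.mul D2).mul D3).mul D4).congr_deriv ?_
      have e1 : κ ^ (α + k - 1) = κ ^ (α - 1) * κ ^ k := by
        rw [← Real.rpow_natCast κ k, ← Real.rpow_add hκ.1]; ring_nf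
      have e2 : κ ^ (α + k) = κ ^ (α - 1) * κ ^ k * κ := by
        rw [← e1, ← Real.rpow_add_one h0]; ring_nf
      have e3 : (1 - κ) ^ b = (1 - κ) ^ (b - 1) * (1 - κ) := by
        rw [← Real.rpow_add_one h1]; ring_nf
      simp only [Pi.mul_apply, Pi.neg_apply, id_eq, e1, e2, e3, hG, priorKappa, logSlope]
      field_simp
      ring
    · rw [intervalIntegrable_iff_integrableOn_Ioo_of_le zero_le_one]
      exact hint
  linarith

end KappaMeasure

/-! ### From moments to minimaxity and the posterior mean. -/

section Estimator

variable {p : ℕ} {a b : ℝ} {h : ℝ → ℝ}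

lemma lintegral_pow_mul_priorKappa (hα : 0 < (p : ℝ) / 2 + a) (hb : 0 < b) (hm : Measurable h)
    (hc : ContinuousOn h (Icc 0 1)) (hpos : ∀ κ ∈ Icc (0 : ℝ) 1, 0 < h κ) (k : ℕ) (s : ℝ) :
    ∫⁻ κ in Ioo (0 : ℝ) 1,
      ENNReal.ofReal (κ ^ ((p : ℝ) / 2 + k) * Real.exp (-κ * s) * priorKappa a b h κ) =
      ENNReal.ofReal (laplace (kappaMeasure ((p : ℝ) / 2 + a) b h) (fun κ => κ ^ k) s) := by
  have := isFiniteMeasure_kappaMeasure hα hb hm hc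
  have hi := (integrable_kappaMeasure_iff hm hpos).mp
    (integrable_laplace_pow (ae_mem_Ioo_kappaMeasure (α := (p : ℝ) / 2 + a) (b := b) (h := h)) k s)
  rw [laplace, integral_kappaMeasure hm hpos, ofReal_integral_eq_lintegral_ofReal hi]
  · refine setLIntegral_congr_fun measurableSet_Ioo fun κ hκ => ?_
    rw [← rpow_mul_priorKappa _ hκ.1, Real.rpow_add hκ.1, Real.rpow_natCast, neg_mul, mul_comm κ s]
    ring_nf
  · refine (ae_restrict_iff' measurableSet_Ioo).mpr (.of_forall fun κ hκ => ?_)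
    exact mul_nonneg (priorKappa_pos hpos κ hκ).le
      (mul_nonneg (pow_nonneg hκ.1.le _) (Real.exp_pos _).le)

lemma shrinkage_eq (hα : 0 < (p : ℝ) / 2 + a) (hb : 0 < b) (hm : Measurable h)
    (hc : ContinuousOn h (Icc 0 1)) (hpos : ∀ κ ∈ Icc (0 : ℝ) 1, 0 < h κ)
    (y : EuclideanSpace ℝ (Fin p)) :
    (shrinkage (priorKappa a b h) y).toReal =
      laplace (kappaMeasure ((p : ℝ) / 2 + a) b h) (fun κ => κ ^ 1) (‖y‖ ^ 2 / 2) /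
        laplace (kappaMeasure ((p : ℝ) / 2 + a) b h) (fun κ => κ ^ 0) (‖y‖ ^ 2 / 2) := by
  have := isFiniteMeasure_kappaMeasure hα hb hm hc
  have hμ := ae_mem_Ioo_kappaMeasure (α := (p : ℝ) / 2 + a) (b := b) (h := h)
  have h1 := lintegral_pow_mul_priorKappa hα hb hm hc hpos 1 (‖y‖ ^ 2 / 2)
  have h0 := lintegral_pow_mul_priorKappa hα hb hm hc hpos 0 (‖y‖ ^ 2 / 2)
  rw [Nat.cast_one] at h1
  rw [Nat.cast_zero, add_zero] at h0
  rw [shrinkage, h1, h0, ENNReal.toReal_div,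
    ENNReal.toReal_ofReal (laplace_pow_pos hμ (kappaMeasure_ne_zero hm hpos) 1 _).le,
    ENNReal.toReal_ofReal (laplace_pow_pos hμ (kappaMeasure_ne_zero hm hpos) 0 _).le]

/-- The denominator is infinite: its integrand is at least a positive constant times `κ⁻¹`, as
`(1-κ)^(b-1) ≥ 1` for `b ≤ 1`. Division by `∞` gives `0` whatever the numerator is. -/
lemma shrinkage_eq_zero (hα : (p : ℝ) / 2 + a = 0) (hb1 : b ≤ 1)
    (hc : ContinuousOn h (Icc 0 1)) (hpos : ∀ κ ∈ Icc (0 : ℝ) 1, 0 < h κ)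
    (y : EuclideanSpace ℝ (Fin p)) : shrinkage (priorKappa a b h) y = 0 := by
  suffices hD : ∫⁻ κ in Ioo (0 : ℝ) 1, ENNReal.ofReal (κ ^ ((p : ℝ) / 2) *
      Real.exp (-κ * (‖y‖ ^ 2 / 2)) * priorKappa a b h κ) = ∞ by
    rw [shrinkage, hD, ENNReal.div_top]
  set s := ‖y‖ ^ 2 / 2
  have hcs : ContinuousOn (fun κ => Real.exp (-κ * s) * h κ) (Icc 0 1) :=
    ContinuousOn.mul (by fun_prop) hc
  obtain ⟨κ₀, hκ₀, hmin⟩ := isCompact_Icc.exists_isMinOn (nonempty_Icc.mpr zero_le_one) hcs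
  set m := Real.exp (-κ₀ * s) * h κ₀ with hmdef
  have hm0 : 0 < m := mul_pos (Real.exp_pos _) (hpos κ₀ hκ₀)
  by_contra hne
  have hbound : ∀ κ ∈ Ioo (0 : ℝ) 1, m * κ ^ (-1 : ℝ) ≤
      κ ^ ((p : ℝ) / 2) * Real.exp (-κ * s) * priorKappa a b h κ := by
    intro κ hκ
    have e : κ ^ ((p : ℝ) / 2) * Real.exp (-κ * s) * priorKappa a b h κ =
        (Real.exp (-κ * s) * h κ) * κ ^ (-1 : ℝ) * (1 - κ) ^ (b - 1) := by
      rw [mul_right_comm, rpow_mul_priorKappa _ hκ.1, hα, priorKappa, zero_sub]; ring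
    have h1 : 1 ≤ (1 - κ) ^ (b - 1) :=
      Real.one_le_rpow_of_pos_of_le_one_of_nonpos (sub_pos.mpr hκ.2) (by linarith [hκ.1])
        (by linarith)
    have h2 : m ≤ Real.exp (-κ * s) * h κ := hmin ⟨hκ.1.le, hκ.2.le⟩
    have h3 : 0 < κ ^ (-1 : ℝ) := Real.rpow_pos_of_pos hκ.1 _
    rw [e]
    calc m * κ ^ (-1 : ℝ) ≤ (Real.exp (-κ * s) * h κ) * κ ^ (-1 : ℝ) :=
          mul_le_mul_of_nonneg_right h2 h3.le
      _ ≤ _ := le_mul_of_one_le_right (mul_nonneg (hm0.le.trans h2) h3.le) h1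
  have hfin : IntegrableOn (fun κ : ℝ => m * κ ^ (-1 : ℝ)) (Ioo 0 1) := by
    refine ⟨by fun_prop, ?_⟩
    rw [hasFiniteIntegral_iff_ofReal]
    · refine lt_of_le_of_lt ?_ (lt_top_iff_ne_top.mpr hne)
      exact setLIntegral_mono' measurableSet_Ioo fun κ hκ =>
        ENNReal.ofReal_le_ofReal (hbound κ hκ)
    · exact (ae_restrict_iff' measurableSet_Ioo).mpr (.of_forall fun κ hκ =>
        mul_nonneg hm0.le (Real.rpow_pos_of_pos hκ.1 _).le)
  have hfin' : IntegrableOn (fun κ : ℝ => κ ^ (-1 : ℝ)) (Ioo 0 1) := by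
    refine (hfin.const_mul m⁻¹).congr (.of_forall fun κ => ?_)
    simp only
    rw [inv_mul_cancel_left₀ hm0.ne']
  rw [intervalIntegral.integrableOn_Ioo_rpow_iff zero_lt_one] at hfin'
  exact lt_irrefl _ hfin'

/-- Minimaxity from Stein's condition on the moments of the posterior of `κ`. -/
lemma isMinimax_bayesEstimator_of_stein (hα : 0 < (p : ℝ) / 2 + a) (hb : 0 < b)
    (hm : Measurable h) (hc : ContinuousOn h (Icc 0 1)) (hpos : ∀ κ ∈ Icc (0 : ℝ) 1, 0 < h κ)
    (hS : ∀ w, 0 ≤ w → 2 * w *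
        laplace (kappaMeasure ((p : ℝ) / 2 + a) b h) (fun κ => κ ^ 2) w *
        laplace (kappaMeasure ((p : ℝ) / 2 + a) b h) (fun κ => κ ^ 0) w
      - w * laplace (kappaMeasure ((p : ℝ) / 2 + a) b h) (fun κ => κ ^ 1) w ^ 2
      - p * laplace (kappaMeasure ((p : ℝ) / 2 + a) b h) (fun κ => κ ^ 1) w *
        laplace (kappaMeasure ((p : ℝ) / 2 + a) b h) (fun κ => κ ^ 0) w ≤ 0) :
    IsMinimax (p := p) (bayesEstimator (priorKappa a b h)) := by
  have := isFiniteMeasure_kappaMeasure hα hb hm hc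
  have hμ := ae_mem_Ioo_kappaMeasure (α := (p : ℝ) / 2 + a) (b := b) (h := h)
  have hμ0 := kappaMeasure_ne_zero (α := (p : ℝ) / 2 + a) (b := b) hm hpos
  set M : ℕ → ℝ → ℝ := fun k => laplace (kappaMeasure ((p : ℝ) / 2 + a) b h) fun κ => κ ^ k
  have hM : ∀ k w, HasDerivAt (M k) (-M (k + 1) w) w := hasDerivAt_laplace_pow hμ
  have hMc : ∀ k, Continuous (M k) := fun k =>
    continuous_iff_continuousAt.mpr fun w => (hM k w).continuousAt
  have hMp : ∀ k w, 0 < M k w := laplace_pow_pos hμ hμ0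
  have hMl : ∀ k w, M (k + 1) w < M k w := laplace_pow_succ_lt hμ hμ0
  set φ : ℝ → ℝ := fun w => M 1 w / M 0 w with hφ
  set φ' : ℝ → ℝ := fun w => (-M 2 w * M 0 w - M 1 w * -M 1 w) / M 0 w ^ 2 with hφ'
  have hd : ∀ w, HasDerivAt φ (φ' w) w := fun w => (hM 1 w).div (hM 0 w) (hMp 0 w).ne'
  have hφ'c : Continuous φ' := by
    refine Continuous.div ?_ ((hMc 0).pow 2) fun w => (pow_pos (hMp 0 w) 2).ne'
    exact (((hMc 2).neg).mul (hMc 0)).sub ((hMc 1).mul (hMc 1).neg)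
  have heq : bayesEstimator (p := p) (priorKappa a b h) =
      fun y => (1 - φ (‖y‖ ^ 2 / 2)) • y := by
    funext y
    rw [bayesEstimator, shrinkage_eq hα hb hm hc hpos]
  have hφc : Continuous φ := (hMc 1).div (hMc 0) fun w => (hMp 0 w).ne'
  rw [heq]
  refine isMinimax_of_risk_le (by fun_prop) (risk_shrink_le hd hφ'c ?_ ?_ ?_)
  · intro w _
    rw [hφ, abs_of_pos (div_pos (hMp 1 w) (hMp 0 w)), div_le_one (hMp 0 w)]
    exact (hMl 0 w).le
  · intro w _
    have p0 := hMp 0 w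
    have p1 := hMp 1 w
    have p2 := hMp 2 w
    have l0 : M 1 w < M 0 w := hMl 0 w
    have l1 : M 2 w < M 1 w := hMl 1 w
    rw [hφ', abs_le, le_div_iff₀ (by positivity), div_le_one (by positivity)]
    constructor <;> nlinarith
  · intro w hw
    have p0 := hMp 0 w
    have h1 : 2 * w * M 2 w * M 0 w - w * M 1 w ^ 2 - p * M 1 w * M 0 w ≤ 0 := hS w hw
    have e : w * φ w ^ 2 - p * φ w - 2 * w * φ' w =
        (2 * w * M 2 w * M 0 w - w * M 1 w ^ 2 - p * M 1 w * M 0 w) / M 0 w ^ 2 := by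
      rw [hφ, hφ']; field_simp; ring
    rw [e]
    exact div_nonpos_of_nonpos_of_nonneg h1 (sq_nonneg _)

/-- The estimator is `y` itself, the case `φ = 0` of the risk bound. -/
lemma isMinimax_bayesEstimator_of_eq_zero (hα : (p : ℝ) / 2 + a = 0) (hb1 : b ≤ 1)
    (hc : ContinuousOn h (Icc 0 1)) (hpos : ∀ κ ∈ Icc (0 : ℝ) 1, 0 < h κ) :
    IsMinimax (p := p) (bayesEstimator (priorKappa a b h)) := by
  have heq : bayesEstimator (p := p) (priorKappa a b h) = fun y => (1 - (0 : ℝ)) • y := by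
    funext y
    rw [bayesEstimator, shrinkage_eq_zero hα hb1 hc hpos, ENNReal.toReal_zero]
  rw [heq]
  exact isMinimax_of_risk_le (by fun_prop) (risk_shrink_le (φ := fun _ => 0) (φ' := fun _ => 0)
    (fun w => hasDerivAt_const w 0) continuous_const (by simp) (by simp) (by simp))

lemma isPosteriorMean_bayesEstimator (hα : 0 < (p : ℝ) / 2 + a) (hb : 0 < b)
    (hm : Measurable h) (hc : ContinuousOn h (Icc 0 1)) (hpos : ∀ κ ∈ Icc (0 : ℝ) 1, 0 < h κ) :
    IsPosteriorMean (p := p) (priorKappa a b h) (bayesEstimator (priorKappa a b h)) := by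
  intro y
  have := isFiniteMeasure_kappaMeasure hα hb hm hc
  have hμ := ae_mem_Ioo_kappaMeasure (α := (p : ℝ) / 2 + a) (b := b) (h := h)
  have hμ0 := kappaMeasure_ne_zero (α := (p : ℝ) / 2 + a) (b := b) hm hpos
  have hq : Measurable (priorKappa a b h) := measurable_priorKappa hm
  have hq0 : ∀ κ ∈ Ioo (0 : ℝ) 1, 0 ≤ priorKappa a b h κ := fun κ hκ =>
    (priorKappa_pos hpos κ hκ).le
  set s := ‖y‖ ^ 2 / 2 with hs
  set c : ℝ := (2 * Real.pi) ^ (-(p : ℝ) / 2) with hcdef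
  have hc0 : 0 < c := by positivity
  have e : ∀ κ ∈ Ioo (0 : ℝ) 1, kappaWeight (priorKappa a b h) y κ =
      c * (priorKappa ((p : ℝ) / 2 + a) b h κ * (κ ^ 0 * Real.exp (-(s * κ)))) := by
    intro κ hκ
    rw [kappaWeight, ← rpow_mul_priorKappa _ hκ.1, neg_mul, mul_comm κ]; ring
  have i0 := integrable_laplace_pow hμ 0 s
  have j0 := (integrable_kappaMeasure_iff hm hpos).mp i0
  have hi : IntegrableOn (kappaWeight (priorKappa a b h) y) (Ioo 0 1) :=
    (j0.const_mul c).congr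
      ((ae_restrict_iff' measurableSet_Ioo).mpr (.of_forall fun κ hκ => (e κ hκ).symm))
  set M := laplace (kappaMeasure ((p : ℝ) / 2 + a) b h) with hM
  have hI0 : ∫ κ in Ioo (0 : ℝ) 1, kappaWeight (priorKappa a b h) y κ =
      c * M (fun κ => κ ^ 0) s := by
    rw [setIntegral_congr_fun measurableSet_Ioo e, integral_const_mul, hM, laplace,
      integral_kappaMeasure hm hpos]
  have hI1 : ∫ κ in Ioo (0 : ℝ) 1, kappaWeight (priorKappa a b h) y κ * (1 - κ) =
      c * (M (fun κ => κ ^ 0) s - M (fun κ => κ ^ 1) s) := by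
    rw [hM, laplace_pow_sub hμ 0, laplace, integral_kappaMeasure hm hpos, ← integral_const_mul]
    refine setIntegral_congr_fun measurableSet_Ioo fun κ hκ => ?_
    rw [e κ hκ]; ring
  have hM0 : 0 < M (fun κ => κ ^ 0) s := laplace_pow_pos hμ hμ0 0 s
  have hpos0 : 0 < ∫ κ in Ioo (0 : ℝ) 1, kappaWeight (priorKappa a b h) y κ := by
    rw [hI0]; positivity
  have hmarg := marginal_eq hq hq0 y hi
  obtain ⟨hint, hmean⟩ := integrable_integral_posterior hq hq0 y hi hpos0
  refine ⟨?_, ?_, hint, ?_⟩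
  · rw [hmarg]; simpa using hpos0
  · rw [hmarg]; exact ENNReal.ofReal_ne_top
  · rw [hmean, hI0, hI1, bayesEstimator, shrinkage_eq hα hb hm hc hpos]
    rw [mul_div_mul_left _ _ hc0.ne', sub_div, div_self hM0.ne']

end Estimator

/-! ### The factor `(1 + c₃ κ)^c₄ e^(dκ)` and its logarithmic slope. -/

section Hypergeometric

variable {c₃ c₄ d : ℝ}

lemma measurable_hypergeometricFactor : Measurable (hypergeometricFactor c₃ c₄ d) := by
  unfold hypergeometricFactor; fun_prop

lemma hypergeometricFactor_pos (hc₃ : 0 < c₃) {κ : ℝ} (hκ : 0 ≤ κ) :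
    0 < hypergeometricFactor c₃ c₄ d κ := by
  unfold hypergeometricFactor; positivity

/-- Since `1 + c₃ κ > 0` on a neighbourhood of `[0,1]`, the derivative is two-sided at the endpoints
too, and `logSlope` has the intended values there. -/
lemma hasDerivAt_hypergeometricFactor (hc₃ : 0 < c₃) {κ : ℝ} (hκ : 0 ≤ κ) :
    HasDerivAt (hypergeometricFactor c₃ c₄ d)
      (hypergeometricFactor c₃ c₄ d κ * (c₃ * c₄ / (1 + c₃ * κ) + d)) κ := by
  have h0 : 0 < 1 + c₃ * κ := by positivity
  have D1 := (((hasDerivAt_id κ).const_mul c₃).const_add 1).rpow_const (p := c₄) (Or.inl h0.ne')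
  have D2 := ((hasDerivAt_id κ).const_mul d).exp
  refine (D1.mul D2).congr_deriv ?_
  have e : (1 + c₃ * κ) ^ c₄ = (1 + c₃ * κ) ^ (c₄ - 1) * (1 + c₃ * κ) := by
    rw [← Real.rpow_add_one h0.ne']; ring_nf
  simp only [hypergeometricFactor, id_eq, e]
  field_simp

lemma logSlope_hypergeometricFactor (hc₃ : 0 < c₃) {κ : ℝ} (hκ : 0 ≤ κ) :
    logSlope (hypergeometricFactor c₃ c₄ d) κ = κ * (c₃ * c₄ / (1 + c₃ * κ) + d) := by
  have := (hypergeometricFactor_pos (c₄ := c₄) (d := d) hc₃ hκ).ne'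
  rw [logSlope, (hasDerivAt_hypergeometricFactor hc₃ hκ).deriv]
  field_simp

lemma continuousOn_hypergeometricFactor (hc₃ : 0 < c₃) :
    ContinuousOn (hypergeometricFactor c₃ c₄ d) (Icc 0 1) := fun _ hκ =>
  (hasDerivAt_hypergeometricFactor hc₃ hκ.1).continuousAt.continuousWithinAt

lemma abs_logSlope_hypergeometricFactor_le (hc₃ : 0 < c₃) {κ : ℝ} (hκ : κ ∈ Ioo (0 : ℝ) 1) :
    |logSlope (hypergeometricFactor c₃ c₄ d) κ| ≤ |c₃ * c₄| + |d| := by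
  rw [logSlope_hypergeometricFactor hc₃ hκ.1.le, abs_mul, abs_of_pos hκ.1]
  have h1 : 1 ≤ 1 + c₃ * κ := by nlinarith [hκ.1]
  have h2 : |c₃ * c₄ / (1 + c₃ * κ)| ≤ |c₃ * c₄| := by
    rw [abs_div, abs_of_pos (by linarith : 0 < 1 + c₃ * κ)]
    exact div_le_self (abs_nonneg _) h1
  calc κ * |c₃ * c₄ / (1 + c₃ * κ) + d| ≤ 1 * (|c₃ * c₄| + |d|) :=
        mul_le_mul hκ.2.le ((abs_add_le _ _).trans (by linarith)) (abs_nonneg _) zero_le_one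
    _ = _ := one_mul _

/-- Reduces monotonicity to the sign of `c₃ c₄ + d t`, where `t = (1 + c₃ x)(1 + c₃ y)` lies in `[1,
(c₃ + 1)²]`. The sign of `d` decides which end of this range is the worst case, whence the two
alternatives for `c₄`. -/
lemma logSlope_hypergeometricFactor_sub (hc₃ : 0 < c₃) {x y : ℝ} (hx : 0 ≤ x) (hy : 0 ≤ y) :
    logSlope (hypergeometricFactor c₃ c₄ d) y - logSlope (hypergeometricFactor c₃ c₄ d) x =
      (y - x) * (c₃ * c₄ + d * ((1 + c₃ * x) * (1 + c₃ * y))) /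
        ((1 + c₃ * x) * (1 + c₃ * y)) := by
  have h1 : 0 < 1 + c₃ * x := by positivity
  have h2 : 0 < 1 + c₃ * y := by positivity
  rw [logSlope_hypergeometricFactor hc₃ hx, logSlope_hypergeometricFactor hc₃ hy]
  field_simp
  ring

lemma one_le_mul_le_sq (hc₃ : 0 < c₃) {x y : ℝ} (hx : x ∈ Icc (0 : ℝ) 1)
    (hy : y ∈ Icc (0 : ℝ) 1) : 1 ≤ (1 + c₃ * x) * (1 + c₃ * y) ∧
      (1 + c₃ * x) * (1 + c₃ * y) ≤ (c₃ + 1) ^ 2 := by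
  have hx1 := mul_nonneg hc₃.le hx.1
  have hy1 := mul_nonneg hc₃.le hy.1
  have hx2 : c₃ * x ≤ c₃ := mul_le_of_le_one_right hc₃.le hx.2
  have hy2 : c₃ * y ≤ c₃ := mul_le_of_le_one_right hc₃.le hy.2
  constructor <;> nlinarith

lemma antitoneOn_logSlope_hypergeometricFactor (hc₃ : 0 < c₃)
    (hcd : (0 ≤ d ∧ c₄ ≤ -((c₃ + 1) ^ 2 * d / c₃)) ∨ (d < 0 ∧ c₄ ≤ -(d / c₃))) :
    AntitoneOn (logSlope (hypergeometricFactor c₃ c₄ d)) (Icc 0 1) := by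
  intro x hx y hy hxy
  rw [← sub_nonpos, logSlope_hypergeometricFactor_sub hc₃ hx.1 hy.1]
  obtain ⟨h1, h2⟩ := one_le_mul_le_sq hc₃ hx hy
  refine div_nonpos_of_nonpos_of_nonneg (mul_nonpos_of_nonneg_of_nonpos (sub_nonneg.mpr hxy) ?_)
    (by linarith)
  rcases hcd with ⟨hd, h⟩ | ⟨hd, h⟩
  · rw [← neg_div, le_div_iff₀ hc₃] at h
    nlinarith
  · rw [← neg_div, le_div_iff₀ hc₃] at h
    nlinarith

lemma monotoneOn_logSlope_hypergeometricFactor (hc₃ : 0 < c₃)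
    (hcd : (0 ≤ d ∧ -(d / c₃) ≤ c₄) ∨ (d < 0 ∧ -((c₃ + 1) ^ 2 * d / c₃) < c₄)) :
    MonotoneOn (logSlope (hypergeometricFactor c₃ c₄ d)) (Icc 0 1) := by
  intro x hx y hy hxy
  rw [← sub_nonneg, logSlope_hypergeometricFactor_sub hc₃ hx.1 hy.1]
  obtain ⟨h1, h2⟩ := one_le_mul_le_sq hc₃ hx hy
  refine div_nonneg (mul_nonneg (sub_nonneg.mpr hxy) ?_) (by linarith)
  rcases hcd with ⟨hd, h⟩ | ⟨hd, h⟩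
  · rw [← neg_div, div_le_iff₀ hc₃] at h
    nlinarith
  · rw [← neg_div, div_lt_iff₀ hc₃] at h
    nlinarith

lemma logSlope_hypergeometricFactor_zero : logSlope (hypergeometricFactor c₃ c₄ d) 0 = 0 := by
  simp [logSlope]

lemma logSlope_hypergeometricFactor_one (hc₃ : 0 < c₃) :
    logSlope (hypergeometricFactor c₃ c₄ d) 1 = d + c₃ * c₄ / (1 + c₃) := by
  rw [logSlope_hypergeometricFactor hc₃ zero_le_one, mul_one, one_mul, add_comm]

lemma measurable_logSlope_hypergeometricFactor :
    Measurable (logSlope (hypergeometricFactor c₃ c₄ d)) := by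
  have h1 := measurable_deriv (hypergeometricFactor c₃ c₄ d)
  have h2 := measurable_hypergeometricFactor (c₃ := c₃) (c₄ := c₄) (d := d)
  unfold logSlope; fun_prop

lemma partsIdentity_hypergeometricFactor {α b : ℝ} (hα : 0 < α) (hb : 0 < b) (hc₃ : 0 < c₃) :
    PartsIdentity (kappaMeasure α b (hypergeometricFactor c₃ c₄ d))
      (logSlope (hypergeometricFactor c₃ c₄ d)) α b :=
  partsIdentity_kappaMeasure hα hb measurable_hypergeometricFactor
    (continuousOn_hypergeometricFactor hc₃) (fun _ hκ => hypergeometricFactor_pos hc₃ hκ.1)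
    (fun _ hκ => (hasDerivAt_hypergeometricFactor hc₃ hκ.1.le).differentiableAt)
    fun _ hκ => abs_logSlope_hypergeometricFactor_le hc₃ hκ

end Hypergeometric

end HalfCauchy

theorem corollary2 (p : ℕ) (a c₃ c₄ d : ℝ)
    (ha : -(p : ℝ) / 2 ≤ a) (ha' : a < (p : ℝ) / 2 - 2) (hc₃ : 0 < c₃) :
    -- part 1
    (((0 ≤ d ∧ c₄ ≤ -((c₃ + 1) ^ 2 * d / c₃)) ∨ (d < 0 ∧ c₄ ≤ -(d / c₃))) →
      -(max ((p : ℝ) / 2 - a - 2) ((p : ℝ) / 2 + a + 2)) ≤ d + c₃ * c₄ / (1 + c₃) →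
      AntitoneOn (HalfCauchy.logSlope (HalfCauchy.hypergeometricFactor c₃ c₄ d))
          (Set.Icc 0 1) ∧
        ∀ b : ℝ, ((p : ℝ) + 2 * a + 2) / (3 * (p : ℝ) / 2 + a) ≤ b → b < 1 →
          HalfCauchy.IsMinimax (p := p) (HalfCauchy.bayesEstimator
            (HalfCauchy.priorKappa a b (HalfCauchy.hypergeometricFactor c₃ c₄ d))) ∧
          (-(p : ℝ) / 2 < a →
            HalfCauchy.IsPosteriorMean (p := p)
              (HalfCauchy.priorKappa a b (HalfCauchy.hypergeometricFactor c₃ c₄ d))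
              (HalfCauchy.bayesEstimator
                (HalfCauchy.priorKappa a b (HalfCauchy.hypergeometricFactor c₃ c₄ d))))) ∧
    -- part 2
    (((0 ≤ d ∧ -(d / c₃) ≤ c₄) ∨ (d < 0 ∧ -((c₃ + 1) ^ 2 * d / c₃) < c₄)) →
      d + c₃ * c₄ / (1 + c₃) ≤ ((p : ℝ) / 2 - a - 2) / 2 →
      MonotoneOn (HalfCauchy.logSlope (HalfCauchy.hypergeometricFactor c₃ c₄ d))
          (Set.Icc 0 1) ∧
        ∀ b : ℝ, ((p : ℝ) + 2 * a + 2 + 2 * (d + c₃ * c₄ / (1 + c₃))) /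
            (3 * (p : ℝ) / 2 + a) ≤ b → b < 1 →
          HalfCauchy.IsMinimax (p := p) (HalfCauchy.bayesEstimator
            (HalfCauchy.priorKappa a b (HalfCauchy.hypergeometricFactor c₃ c₄ d))) ∧
          (-(p : ℝ) / 2 < a →
            HalfCauchy.IsPosteriorMean (p := p)
              (HalfCauchy.priorKappa a b (HalfCauchy.hypergeometricFactor c₃ c₄ d))
              (HalfCauchy.bayesEstimator
                (HalfCauchy.priorKappa a b (HalfCauchy.hypergeometricFactor c₃ c₄ d))))) := by
  have hp : 2 < (p : ℝ) := by linarith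
  have hα : 0 ≤ (p : ℝ) / 2 + a := by linarith
  have hpα : 0 < 3 * (p : ℝ) / 2 + a := by linarith
  have hm := HalfCauchy.measurable_hypergeometricFactor (c₃ := c₃) (c₄ := c₄) (d := d)
  have hHm := HalfCauchy.measurable_logSlope_hypergeometricFactor (c₃ := c₃) (c₄ := c₄) (d := d)
  have hc := HalfCauchy.continuousOn_hypergeometricFactor (c₄ := c₄) (d := d) hc₃
  have hpos : ∀ κ ∈ Icc (0 : ℝ) 1, 0 < HalfCauchy.hypergeometricFactor c₃ c₄ d κ :=
    fun κ hκ => HalfCauchy.hypergeometricFactor_pos hc₃ hκ.1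
  have hH0 := HalfCauchy.logSlope_hypergeometricFactor_zero (c₃ := c₃) (c₄ := c₄) (d := d)
  have hH1 := HalfCauchy.logSlope_hypergeometricFactor_one (c₄ := c₄) (d := d) hc₃
  refine ⟨fun hcd _ => ?_, fun hcd _ => ?_⟩
  · have hH := HalfCauchy.antitoneOn_logSlope_hypergeometricFactor hc₃ hcd
    refine ⟨hH, fun b hb hb1 => ?_⟩
    -- With `α = p/2 + a` this reads `2α + 2 ≤ b (p + α)`; it also forces `b > 0`, as `α ≥ 0`.
    rw [div_le_iff₀ hpα] at hb
    have hb0 : 0 < b := pos_of_mul_pos_left (by linarith) hpα.le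
    refine ⟨?_, fun ha'' => HalfCauchy.isPosteriorMean_bayesEstimator (by linarith) hb0 hm hc hpos⟩
    rcases hα.eq_or_lt with h | h
    · exact HalfCauchy.isMinimax_bayesEstimator_of_eq_zero h.symm hb1.le hc hpos
    · have := HalfCauchy.isFiniteMeasure_kappaMeasure h hb0 hm hc
      exact HalfCauchy.isMinimax_bayesEstimator_of_stein h hb0 hm hc hpos fun w hw =>
        HalfCauchy.stein_condition_of_antitone HalfCauchy.ae_mem_Ioo_kappaMeasure
          (HalfCauchy.kappaMeasure_ne_zero hm hpos) hHm hH hH0 hα hb0 hb1.le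
          (HalfCauchy.partsIdentity_hypergeometricFactor h hb0 hc₃) (by linarith) hw
  · have hH := HalfCauchy.monotoneOn_logSlope_hypergeometricFactor hc₃ hcd
    -- Needed for `b > 0`: the numerator in the bound on `b` is `2α + 2 + 2 H(1)`.
    have hH1' : 0 ≤ HalfCauchy.logSlope (HalfCauchy.hypergeometricFactor c₃ c₄ d) 1 := by
      have := hH ⟨le_rfl, zero_le_one⟩ ⟨zero_le_one, le_rfl⟩ zero_le_one
      rwa [hH0] at this
    refine ⟨hH, fun b hb hb1 => ?_⟩
    rw [div_le_iff₀ hpα, ← hH1] at hb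
    have hb0 : 0 < b := pos_of_mul_pos_left (by linarith) hpα.le
    refine ⟨?_, fun ha'' => HalfCauchy.isPosteriorMean_bayesEstimator (by linarith) hb0 hm hc hpos⟩
    rcases hα.eq_or_lt with h | h
    · exact HalfCauchy.isMinimax_bayesEstimator_of_eq_zero h.symm hb1.le hc hpos
    · have := HalfCauchy.isFiniteMeasure_kappaMeasure h hb0 hm hc
      exact HalfCauchy.isMinimax_bayesEstimator_of_stein h hb0 hm hc hpos fun w hw =>
        HalfCauchy.stein_condition_of_monotone HalfCauchy.ae_mem_Ioo_kappaMeasure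
          (HalfCauchy.kappaMeasure_ne_zero hm hpos) hHm hH hH0 hα hb0 hb1.le
          (HalfCauchy.partsIdentity_hypergeometricFactor h hb0 hc₃) (by linarith) hw
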